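/- Let $n,m\ge 1$ and $\mathbf R^{1+n}_+=\{(t,x): t>0,\ x\in\mathbf R^n\}$. All functions $f$ below are measurable functions $\mathbf R^{1+n}_+\to\mathbf C^{(1+n)m}$. For $t>0$ put $W(t,x)=\{(s,y): 1/2<s/t<2,\ |y-x|<t\}$, $W_2f(t,x)=t^{-(1+n)/2}\|f\|_{L_2(W(t,x))}$ and $W_\infty g(t,x)=\|g\|_{L_\infty(W(t,x))}$. For $g\colon\mathbf R^{1+n}_+\to[0,\infty]$ and $x\in\mathbf R^n$ put $$Ng(x)=\sup_{|y-x|<s}g(s,y),\qquad Cg(x)=\sup_{r>0}r^{-n}\iint_{s>0,\ |y-x|<r-s}g(s,y)\,ds\,dy,\qquad Ag(x)=\iint_{|y-x|<s}g(s,y)s^{-n}\,ds\,dy.$$ Let $N_{2,2}$ be the space of all $f$ with $\|f\|_{N_{2,2}}=\|N(W_2f)\|_{L_2(\mathbf R^n)}<\infty$; let $C_{2,2}$ be the space of all $f$ with $\|f\|_{C_{2,2}}<\infty$, where $\|f\|_{C_{2,2}}$ denotes either $\|C(W_2f)\|_{L_2(\mathbf R^n)}$ or the equivalent norm $\|A(W_2f)\|_{L_2(\mathbf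 R^n)}$ (the result holds for each choice); and let $L_2(t^{\alpha})$ be the space of all $f$ with $\|f\|_{L_2(t^\alpha)}^2=\iint|f(t,x)|^2t^\alpha\,dt\,dx<\infty$. For a measurable $\mathcal E\colon\mathbf R^{1+n}_+\to\mathcal L(\mathbf C^{(1+n)m})$, acting by $(\mathcal Ef)(t,x)=\mathcal E(t,x)f(t,x)$, let $|\mathcal E(t,x)|$ be the operator norm and define the Carleson--Dahlberg norm $$\|\mathcal E\|_*=\big\|C\big(W_\infty(|\mathcal E|^2/t)\big)\big\|_{L_\infty(\mathbf R^n)}^{1/2}.$$ Theorem 2.4. For every measurable $\mathcal E$ the following are equivalent: (i) $\mathcal E$ is bounded $N_{2,2}\to L_2(t^{-1})$; (ii) $\mathcal E$ is bounded $L_2(t)\to C_{2,2}$; (iii) $\|\mathcal E\|_*<\infty$. Moreover $$\|\mathcal E\|_*\approx\sup_{\|f\|_{N_{2,2}}=1}\|\mathcal Ef\|_{L_2(t^{-1})}\approx\sup_{\|f\|_{L_2(t)}=1}\|\mathcal Ef\|_{C_{2,2}},$$ where the quantities take values in $[0,\infty]$ and the implied constants depend only on $n$ and $m$, not on $\mathcal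 E$. -/

import Mathlib

open MeasureTheory
open scoped ENNReal NNReal

noncomputable section

namespace CarlesonMult

/-- The space `ℝ × ℝⁿ` of points `(t, x)`, with the Euclidean norm on `ℝⁿ`. -/
abbrev Pt (n : ℕ) : Type := ℝ × EuclideanSpace ℝ (Fin n)

/-- The range `ℂ^{(1+n)m}` of the functions, with its Euclidean norm. -/
abbrev Val (n m : ℕ) : Type := EuclideanSpace ℂ (Fin ((1 + n) * m))

/-- The open upper half space `t > 0`. Functions on it are represented by functions on `Pt n`
whose values at `t ≤ 0` play no role. -/
def halfSpace (n : ℕ) : Set (Pt n) := {p | 0 < p.1}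

/-- Lebesgue measure `dt dx` on the upper half space. -/
def halfVol (n : ℕ) : Measure (Pt n) := volume.restrict (halfSpace n)

/-- The Whitney region `W(t,x) = {(s,y) : 1/2 < s/t < 2, |y - x| < t}`. -/
def whitney {n : ℕ} (p : Pt n) : Set (Pt n) :=
  {q | 1 / 2 < q.1 / p.1 ∧ q.1 / p.1 < 2 ∧ ‖q.2 - p.2‖ < p.1}

/-- The `L_2` Whitney average `W_2 f(t,x) = t^{-(1+n)/2} ‖f‖_{L_2(W(t,x))}`, for `t > 0`. -/
def whitneyTwo {n : ℕ} {F : Type*} [NormedAddCommGroup F] (f : Pt n → F) (p : Pt n) : ℝ≥0∞ :=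
  ENNReal.ofReal (p.1 ^ (-(1 + (n : ℝ)) / 2)) * eLpNorm f 2 (volume.restrict (whitney p))

/-- The `L_∞` Whitney average `W_∞ f(t,x) = ‖f‖_{L_∞(W(t,x))}`, for `t > 0`. -/
def whitneySup {n : ℕ} {F : Type*} [NormedAddCommGroup F] (f : Pt n → F) (p : Pt n) : ℝ≥0∞ :=
  eLpNorm f ⊤ (volume.restrict (whitney p))

/-- The non-tangential maximal function `N g(x) = sup_{|y - x| < s} g(s,y)`. -/
def nonTangMax {n : ℕ} (g : Pt n → ℝ≥0∞) (x : EuclideanSpace ℝ (Fin n)) : ℝ≥0∞ :=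
  ⨆ (p : Pt n) (_ : ‖p.2 - x‖ < p.1), g p

/-- The Carleson functional `C g(x) = sup_{r > 0} r^{-n} ∬_{s > 0, |y - x| < r - s} g(s,y) ds dy`. -/
def carlesonFun {n : ℕ} (g : Pt n → ℝ≥0∞) (x : EuclideanSpace ℝ (Fin n)) : ℝ≥0∞ :=
  ⨆ (r : ℝ) (_ : 0 < r),
    (ENNReal.ofReal (r ^ n))⁻¹ * ∫⁻ p in {p : Pt n | 0 < p.1 ∧ ‖p.2 - x‖ < r - p.1}, g p

/-- The area functional `A g(x) = ∬_{|y - x| < s} g(s,y) s^{-n} ds dy`. -/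
def areaFun {n : ℕ} (g : Pt n → ℝ≥0∞) (x : EuclideanSpace ℝ (Fin n)) : ℝ≥0∞ :=
  ∫⁻ p in {p : Pt n | ‖p.2 - x‖ < p.1}, g p * (ENNReal.ofReal (p.1 ^ n))⁻¹

/-- The norm `‖N(W_2 f)‖_2` of `N_{2,2}`. -/
def normN {n m : ℕ} (f : Pt n → Val n m) : ℝ≥0∞ :=
  eLpNorm (nonTangMax (whitneyTwo f)) 2 volume

/-- The norm `‖C(W_2 f)‖_2` of `C_{2,2}`. -/
def normC {n m : ℕ} (f : Pt n → Val n m) : ℝ≥0∞ :=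
  eLpNorm (carlesonFun (whitneyTwo f)) 2 volume

/-- The second norm `‖A(W_2 f)‖_2` of `C_{2,2}`. -/
def normA {n m : ℕ} (f : Pt n → Val n m) : ℝ≥0∞ :=
  eLpNorm (areaFun (whitneyTwo f)) 2 volume

/-- The norm `(∬ |f(t,x)|² t^α dt dx)^{1/2}` of `L_2(t^α)`. -/
def normL2 {n m : ℕ} (α : ℝ) (f : Pt n → Val n m) : ℝ≥0∞ :=
  (∫⁻ p, ‖f p‖ₑ ^ 2 * ENNReal.ofReal (p.1 ^ α) ∂(halfVol n)) ^ (1 / 2 : ℝ)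

/-- Membership in the function space with norm `ν`: `f` is measurable on the half space
and has finite norm. -/
def MemSpace {n m : ℕ} (ν : (Pt n → Val n m) → ℝ≥0∞) (f : Pt n → Val n m) : Prop :=
  AEStronglyMeasurable f (halfVol n) ∧ ν f < ∞

/-- The multiplication operator `f(t,x) ↦ 𝓔(t,x) f(t,x)`. -/
def mult {n m : ℕ} (E : Pt n → (Val n m →L[ℂ] Val n m)) (f : Pt n → Val n m) : Pt n → Val n m :=
  fun p => E p (f p)

/-- Multiplication by `E` is bounded from the space with norm `ν` to the space with norm `ν'`. -/
def IsBoundedMult {n m : ℕ} (ν ν' : (Pt n → Val n m) → ℝ≥0∞)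
    (E : Pt n → (Val n m →L[ℂ] Val n m)) : Prop :=
  ∃ K : ℝ≥0, ∀ f, MemSpace ν f → MemSpace ν' (mult E f) ∧ ν' (mult E f) ≤ K * ν f

/-- The operator norm `sup_{ν f = 1} ν'(E f)`, an element of `[0,∞]`. -/
def opNorm {n m : ℕ} (ν ν' : (Pt n → Val n m) → ℝ≥0∞)
    (E : Pt n → (Val n m →L[ℂ] Val n m)) : ℝ≥0∞ :=
  ⨆ (f : Pt n → Val n m) (_ : MemSpace ν f ∧ ν f = 1), ν' (mult E f)

/-- The Carleson-Dahlberg norm `‖E‖_* = ‖C(W_∞(|E|²/t))‖_∞^{1/2}`,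
where `|E(t,x)|` is the operator norm. -/
def carlesonDahlberg {n m : ℕ} (E : Pt n → (Val n m →L[ℂ] Val n m)) : ℝ≥0∞ :=
  (eLpNorm (carlesonFun (whitneySup fun p : Pt n => ‖E p‖ ^ 2 / p.1)) ⊤
    (volume : Measure (EuclideanSpace ℝ (Fin n)))) ^ (1 / 2 : ℝ)

/-- `a ≈ b` with constant `K`. -/
def Comparable (K : ℝ≥0) (a b : ℝ≥0∞) : Prop := a ≤ K * b ∧ b ≤ K * a

end CarlesonMult

end

noncomputable section

namespace CarlesonMult

open Set Metric Filter

/-! The proof rests on three estimates. Write `W_∞(|E|²/t) dt dx = dμ`; finiteness of `‖E‖_*` says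
that `μ` is a Carleson measure.

* `N_{2,2} → L_2(t⁻¹)`: averaging over Whitney regions bounds `∬ |Ef|²/t` by `∬ (W_2 f)² dμ`, and
  the Carleson embedding bounds this by `‖E‖_*² ∫ N(W_2 f)²`.
* `L_2(t) → C_{2,2}`: against `φ ∈ L_2`, Tonelli turns `∫ A(W_2(Ef)) φ` into
  `∬ W_2(Ef) φ_t`, with `φ_t` the averages of `φ` over balls of radius `t`. Since
  `W_2(Ef)² ≤ W_∞(|E|²/t) W_2(t^{1/2} f)²`, Cauchy-Schwarz leaves `∬ φ_t² dμ`, which the Carleson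
  embedding and the maximal theorem control by `‖E‖_*² ‖φ‖²`. Moreover `C g` is dominated by the
  maximal function of `A g`, so that `‖C g‖_2 ≲ ‖A g‖_2`.
* Conversely, it suffices to consider `|Ev|²/t` for finitely many unit vectors `v`. Over a tent `T`,
  the essential suprema in `∬_T W_∞(|Ev|²/t)` are nearly attained on pieces of positive measure of
  the Whitney regions. Spreading the mass at each point of `T` over its piece gives a density `φ²`
  with bounded Whitney averages and `∬_T W_∞(|Ev|²/t) ≲ ∬ φ² |Ev|²/t`. The right-hand side is
  controlled by testing `E` on `φ v ∈ N_{2,2}`, and also on `φ (|Ev|/t) v ∈ L_2(t)`. -/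

section Tonelli

variable {α β : Type*} [MeasurableSpace α] [MeasurableSpace β]

lemma lintegral_preimage_mk {ν : Measure β} {R : Set (α × β)} (hR : MeasurableSet R)
    (f : α × β → ℝ≥0∞) (x : α) :
    ∫⁻ y in Prod.mk x ⁻¹' R, f (x, y) ∂ν = ∫⁻ y, R.indicator f (x, y) ∂ν :=
  (lintegral_indicator (measurable_prodMk_left hR) fun y => f (x, y)).symm

lemma measurable_lintegral_preimage_mk {ν : Measure β} [SFinite ν] {R : Set (α × β)}
    (hR : MeasurableSet R) {f : α × β → ℝ≥0∞} (hf : Measurable f) :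
    Measurable fun x => ∫⁻ y in Prod.mk x ⁻¹' R, f (x, y) ∂ν := by
  simp only [lintegral_preimage_mk hR]
  exact (hf.indicator hR).lintegral_prod_right'

lemma lintegral_lintegral_preimage_mk {μ : Measure α} {ν : Measure β} [SFinite μ] [SFinite ν]
    {R : Set (α × β)} (hR : MeasurableSet R) {f : α × β → ℝ≥0∞} (hf : Measurable f) :
    ∫⁻ x, ∫⁻ y in Prod.mk x ⁻¹' R, f (x, y) ∂ν ∂μ =
      ∫⁻ y, ∫⁻ x in {x | (x, y) ∈ R}, f (x, y) ∂μ ∂ν := by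
  simp only [lintegral_preimage_mk hR]
  rw [lintegral_lintegral_swap (f := fun x y => R.indicator f (x, y))
    (hf.indicator hR).aemeasurable]
  exact lintegral_congr fun y =>
    lintegral_indicator (measurable_prodMk_right hR) fun x => f (x, y)

end Tonelli

section LayerCake

lemma superlevel_inter_Ioi {a : ℝ≥0∞} (ha : a ≠ ⊤) :
    {t : ℝ | ENNReal.ofReal t < a} ∩ Ioi 0 = Ioo 0 a.toReal := by
  ext t
  simp only [mem_inter_iff, mem_ofPred_eq, mem_Ioi, mem_Ioo]
  exact ⟨fun h => ⟨h.2, (ENNReal.ofReal_lt_iff_lt_toReal h.2.le ha).1 h.1⟩,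
    fun h => ⟨(ENNReal.ofReal_lt_iff_lt_toReal h.1.le ha).2 h.2, h.1⟩⟩

lemma volume_superlevel_Ioi (a : ℝ≥0∞) :
    volume.restrict (Ioi (0 : ℝ)) {t | ENNReal.ofReal t < a} = a := by
  rw [Measure.restrict_apply (measurableSet_lt ENNReal.measurable_ofReal measurable_const)]
  rcases eq_or_ne a ⊤ with rfl | ha
  · simp
  · rw [superlevel_inter_Ioi ha, Real.volume_Ioo, sub_zero, ENNReal.ofReal_toReal ha]

lemma lintegral_superlevel_two_mul (a : ℝ≥0∞) :
    ∫⁻ t in {t | ENNReal.ofReal t < a}, 2 * ENNReal.ofReal t ∂volume.restrict (Ioi (0 : ℝ)) =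
      a ^ 2 := by
  rw [Measure.restrict_restrict (measurableSet_lt ENNReal.measurable_ofReal measurable_const)]
  rcases eq_or_ne a ⊤ with rfl | ha
  · simp only [ENNReal.ofReal_lt_top, ofPred_true, univ_inter, ENNReal.top_pow two_ne_zero]
    refine eq_top_iff.2 ?_
    calc (⊤ : ℝ≥0∞) = ∫⁻ _ in Ioi (1 : ℝ), 1 := by simp
      _ ≤ ∫⁻ t in Ioi (1 : ℝ), 2 * ENNReal.ofReal t :=
        setLIntegral_mono (by fun_prop) fun t ht =>
          one_le_mul one_le_two (ENNReal.one_le_ofReal.2 (le_of_lt ht))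
      _ ≤ _ := lintegral_mono_set (Ioi_subset_Ioi zero_le_one)
  · have hint : IntegrableOn (fun t : ℝ => 2 * t) (Ioc 0 a.toReal) :=
      (Continuous.integrableOn_Icc (by fun_prop)).mono_set Ioc_subset_Icc_self
    have hnn : 0 ≤ᵐ[volume.restrict (Ioc 0 a.toReal)] fun t : ℝ => 2 * t :=
      (ae_restrict_mem measurableSet_Ioc).mono fun t ht => mul_nonneg zero_le_two ht.1.le
    simp_rw [superlevel_inter_Ioi ha, Measure.restrict_congr_set Ioo_ae_eq_Ioc,
      ← ENNReal.ofReal_ofNat 2, ← ENNReal.ofReal_mul (zero_le_two (α := ℝ))]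
    rw [← ofReal_integral_eq_lintegral_ofReal hint hnn,
      ← intervalIntegral.integral_of_le ENNReal.toReal_nonneg,
      intervalIntegral.integral_const_mul, integral_id, sub_eq_self.2 (zero_pow two_ne_zero),
      mul_div_cancel₀ _ two_ne_zero, ENNReal.ofReal_pow ENNReal.toReal_nonneg,
      ENNReal.ofReal_toReal ha]

variable {α : Type*} [MeasurableSpace α] {μ : Measure α} [SFinite μ] {g : α → ℝ≥0∞}

lemma lintegral_lintegral_superlevel (hg : Measurable g) {κ : ℝ → ℝ≥0∞} (hκ : Measurable κ) :
    ∫⁻ x, ∫⁻ t in {t | ENNReal.ofReal t < g x}, κ t ∂volume.restrict (Ioi (0 : ℝ)) ∂μ =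
      ∫⁻ t in Ioi (0 : ℝ), κ t * μ {x | ENNReal.ofReal t < g x} := by
  have hR : MeasurableSet {z : α × ℝ | ENNReal.ofReal z.2 < g z.1} :=
    measurableSet_lt (by fun_prop) (by fun_prop)
  refine (lintegral_lintegral_preimage_mk hR (f := fun z => κ z.2) (by fun_prop)).trans ?_
  exact lintegral_congr fun t => setLIntegral_const {x | ENNReal.ofReal t < g x} (κ t)

lemma lintegral_eq_lintegral_superlevel (hg : Measurable g) :
    ∫⁻ x, g x ∂μ = ∫⁻ t in Ioi (0 : ℝ), μ {x | ENNReal.ofReal t < g x} := by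
  simpa only [setLIntegral_const, volume_superlevel_Ioi, one_mul] using
    lintegral_lintegral_superlevel (μ := μ) hg (measurable_const (a := 1))

lemma lintegral_sq_eq_lintegral_superlevel (hg : Measurable g) :
    ∫⁻ x, g x ^ 2 ∂μ =
      ∫⁻ t in Ioi (0 : ℝ), 2 * ENNReal.ofReal t * μ {x | ENNReal.ofReal t < g x} := by
  simpa only [lintegral_superlevel_two_mul] using
    lintegral_lintegral_superlevel (μ := μ) (κ := fun t => 2 * ENNReal.ofReal t) hg (by fun_prop)

end LayerCake

section Squares

variable {α : Type*} [MeasurableSpace α] {μ : Measure α}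

lemma eLpNorm_two_sq {ε : Type*} [ENorm ε] (f : α → ε) (μ : Measure α) :
    eLpNorm f 2 μ ^ 2 = ∫⁻ x, ‖f x‖ₑ ^ 2 ∂μ := by
  rw [eLpNorm_eq_lintegral_rpow_enorm_toReal two_ne_zero (by simp)]
  simp only [ENNReal.toReal_ofNat, ENNReal.rpow_ofNat]
  rw [← ENNReal.rpow_two, ← ENNReal.rpow_mul]
  norm_num

lemma rpow_half_sq (a : ℝ≥0∞) : (a ^ (1 / 2 : ℝ)) ^ 2 = a := by
  rw [← ENNReal.rpow_two, ← ENNReal.rpow_mul]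
  norm_num

lemma lintegral_mul_sq_le {f g : α → ℝ≥0∞} (hf : AEMeasurable f μ) (hg : AEMeasurable g μ) :
    (∫⁻ x, f x * g x ∂μ) ^ 2 ≤ (∫⁻ x, f x ^ 2 ∂μ) * ∫⁻ x, g x ^ 2 ∂μ := by
  have := ENNReal.lintegral_mul_le_Lp_mul_Lq μ Real.HolderConjugate.two_two hf hg
  simp only [Pi.mul_apply, ENNReal.rpow_two] at this
  calc _ ≤ _ := pow_le_pow_left' this 2
    _ = _ := by rw [mul_pow, rpow_half_sq, rpow_half_sq]

lemma le_rpow_half_mul_of_sq_le {a b c : ℝ≥0∞} (h : a ^ 2 ≤ b * c) :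
    a ≤ b ^ (1 / 2 : ℝ) * c ^ (1 / 2 : ℝ) := by
  rw [← ENNReal.pow_le_pow_left_iff two_ne_zero, mul_pow, rpow_half_sq, rpow_half_sq]
  exact h

lemma lintegral_mul_sq_le_of_sq_le {w S U ψ : α → ℝ≥0∞} (hS : Measurable S) (hU : Measurable U)
    (hψ : Measurable ψ) (hw : ∀ x, w x ^ 2 ≤ S x * U x) :
    (∫⁻ x, w x * ψ x ∂μ) ^ 2 ≤ (∫⁻ x, S x * ψ x ^ 2 ∂μ) * ∫⁻ x, U x ∂μ := by
  calc (∫⁻ x, w x * ψ x ∂μ) ^ 2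
      ≤ (∫⁻ x, (S x ^ (1 / 2 : ℝ) * ψ x) * U x ^ (1 / 2 : ℝ) ∂μ) ^ 2 := by
        refine pow_le_pow_left' (lintegral_mono fun x => ?_) 2
        rw [mul_right_comm]
        gcongr
        exact le_rpow_half_mul_of_sq_le (hw x)
    _ ≤ (∫⁻ x, (S x ^ (1 / 2 : ℝ) * ψ x) ^ 2 ∂μ) * ∫⁻ x, (U x ^ (1 / 2 : ℝ)) ^ 2 ∂μ :=
        lintegral_mul_sq_le ((hS.pow_const _).mul hψ).aemeasurable
          (hU.pow_const _).aemeasurable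
    _ = _ := by simp_rw [mul_pow, rpow_half_sq]

lemma exists_simpleFunc_lintegral_lt [SigmaFinite μ] {f : α → ℝ≥0∞} {L : ℝ≥0∞}
    (hL : L < ∫⁻ x, f x ∂μ) :
    ∃ g : SimpleFunc α ℝ≥0, (∀ x, g x ≤ f x) ∧ ∫⁻ x, g x ∂μ < ∞ ∧ L < ∫⁻ x, g x ∂μ := by
  simp_rw [lintegral_eq_nnreal, lt_iSup_iff] at hL
  obtain ⟨g₀, hg₀, hL⟩ := hL
  rw [← SimpleFunc.lintegral_eq_lintegral] at hL
  obtain ⟨g, hgg₀, hg⟩ := SimpleFunc.exists_lt_lintegral_simpleFunc_of_lt_lintegral hL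
  exact ⟨g, fun x => (ENNReal.coe_le_coe.2 (hgg₀ x)).trans (hg₀ x), hg⟩

lemma lintegral_sq_le_of_dual [SigmaFinite μ] {f : α → ℝ≥0∞} {D : ℝ≥0∞}
    (h : ∀ φ : α → ℝ≥0∞, Measurable φ → (∫⁻ x, f x * φ x ∂μ) ^ 2 ≤ D * ∫⁻ x, φ x ^ 2 ∂μ) :
    ∫⁻ x, f x ^ 2 ∂μ ≤ D := by
  refine le_of_forall_lt fun L hL => ?_
  obtain ⟨g, hgf, hg_top, hLg⟩ := exists_simpleFunc_lintegral_lt hL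
  set I := ∫⁻ x, (g x : ℝ≥0∞) ∂μ
  have hφ_sq (x) : ((g x : ℝ≥0∞) ^ (1 / 2 : ℝ)) ^ 2 = g x := rpow_half_sq _
  have hI : I ≤ ∫⁻ x, f x * (g x : ℝ≥0∞) ^ (1 / 2 : ℝ) ∂μ := by
    refine lintegral_mono fun x => ?_
    have hle : (g x : ℝ≥0∞) ^ (1 / 2 : ℝ) ≤ f x := by
      rw [← ENNReal.pow_le_pow_left_iff two_ne_zero, hφ_sq]; exact hgf x
    calc (g x : ℝ≥0∞) = (g x : ℝ≥0∞) ^ (1 / 2 : ℝ) * (g x : ℝ≥0∞) ^ (1 / 2 : ℝ) := by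
          rw [← sq, hφ_sq]
      _ ≤ _ := by gcongr
  have hII : I * I ≤ D * I := by
    calc I * I ≤ (∫⁻ x, f x * (g x : ℝ≥0∞) ^ (1 / 2 : ℝ) ∂μ) ^ 2 := by rw [← sq]; gcongr
      _ ≤ D * ∫⁻ x, ((g x : ℝ≥0∞) ^ (1 / 2 : ℝ)) ^ 2 ∂μ :=
        h _ (g.measurable.coe_nnreal_ennreal.pow_const _)
      _ = D * I := by simp_rw [hφ_sq]; rfl
  exact hLg.trans_le ((ENNReal.mul_le_mul_iff_left (bot_le.trans_lt hLg).ne' hg_top.ne).1 hII)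

end Squares

section Balls

variable {n : ℕ}

/-- The volume of the unit ball of `ℝⁿ`. -/
def unitVol (n : ℕ) : ℝ≥0 := (volume (ball (0 : EuclideanSpace ℝ (Fin n)) 1)).toNNReal

lemma unitVol_ne_zero (n : ℕ) : unitVol n ≠ 0 :=
  (ENNReal.toNNReal_pos (measure_ball_pos _ _ one_pos).ne' measure_ball_lt_top.ne).ne'

lemma coe_unitVol_ne_zero (n : ℕ) : (unitVol n : ℝ≥0∞) ≠ 0 :=
  ENNReal.coe_ne_zero.2 (unitVol_ne_zero n)

lemma coe_unitVol_inv_ne_top (n : ℕ) : (unitVol n : ℝ≥0∞)⁻¹ ≠ ∞ :=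
  ENNReal.inv_ne_top.2 (coe_unitVol_ne_zero n)

lemma ofReal_pow_ne_zero {r : ℝ} (hr : 0 < r) (n : ℕ) : ENNReal.ofReal (r ^ n) ≠ 0 :=
  (ENNReal.ofReal_pos.2 (pow_pos hr n)).ne'

lemma ofReal_mul_pow {c : ℝ} (hc : 0 ≤ c) (r : ℝ) (n : ℕ) :
    ENNReal.ofReal ((c * r) ^ n) = ENNReal.ofReal c ^ n * ENNReal.ofReal (r ^ n) := by
  rw [mul_pow, ENNReal.ofReal_mul (pow_nonneg hc n), ENNReal.ofReal_pow hc]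

lemma volume_ball_eq (x : EuclideanSpace ℝ (Fin n)) {r : ℝ} (hr : 0 < r) :
    volume (ball x r) = unitVol n * ENNReal.ofReal (r ^ n) := by
  rw [Measure.addHaar_ball_of_pos _ _ hr, finrank_euclideanSpace_fin, unitVol,
    ENNReal.coe_toNNReal measure_ball_lt_top.ne, mul_comm]

lemma exists_vitali_subfamily {t : Set (Pt n)} (ht : t ⊆ halfSpace n) {R : ℝ}
    (hR : ∀ p ∈ t, p.1 ≤ R) :
    ∃ u ⊆ t, u.Countable ∧ (u.PairwiseDisjoint fun p => ball p.2 p.1) ∧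
      ∀ p ∈ t, ∃ q ∈ u, p.1 ≤ 2 * q.1 ∧ ‖p.2 - q.2‖ < 3 * q.1 := by
  obtain ⟨u, hut, hdisj, hcov⟩ := Vitali.exists_disjoint_subfamily_covering_enlargement
    (fun p : Pt n => ball p.2 p.1) t (fun p => p.1) 2 one_lt_two (fun p hp => (ht hp).le) R hR
    (fun p hp => nonempty_ball.2 (ht hp))
  refine ⟨u, hut, hdisj.countable_of_isOpen (fun _ _ => isOpen_ball)
    (fun p hp => nonempty_ball.2 (ht (hut hp))), hdisj, fun p hp => ?_⟩
  obtain ⟨q, hq, ⟨z, hz1, hz2⟩, hle⟩ := hcov p hp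
  refine ⟨q, hq, hle, ?_⟩
  rw [mem_ball] at hz1 hz2
  rw [← dist_eq_norm]
  linarith [dist_triangle_left p.2 q.2 z]

lemma monotone_sep_fst_le (t : Set (Pt n)) : Monotone fun k : ℕ => {p ∈ t | p.1 ≤ k} :=
  fun _ _ hij _ hp => ⟨hp.1, hp.2.trans (Nat.cast_le.2 hij)⟩

lemma iUnion_sep_fst_le (t : Set (Pt n)) : ⋃ k : ℕ, {p ∈ t | p.1 ≤ k} = t := by
  ext p
  simpa only [mem_iUnion, mem_ofPred_eq, exists_and_left, and_iff_left_iff_imp] using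
    fun _ => exists_nat_ge p.1

lemma volume_biUnion_ball_le {t : Set (Pt n)} (ht : t ⊆ halfSpace n)
    {ν : Measure (EuclideanSpace ℝ (Fin n))}
    (hν : ∀ p ∈ t, ENNReal.ofReal (p.1 ^ n) ≤ ν (ball p.2 p.1)) :
    volume (⋃ p ∈ t, ball p.2 p.1) ≤ 5 ^ n * unitVol n * ν univ := by
  suffices hbdd : ∀ k : ℕ, volume (⋃ p ∈ {p ∈ t | p.1 ≤ k}, ball p.2 p.1) ≤
      5 ^ n * unitVol n * ν univ by
    have hmono : Monotone fun k : ℕ => ⋃ p ∈ {p ∈ t | p.1 ≤ k}, ball p.2 p.1 :=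
      fun i j hij => biUnion_subset_biUnion_left (monotone_sep_fst_le t hij)
    rw [← iUnion_sep_fst_le t, biUnion_iUnion, hmono.measure_iUnion]
    exact iSup_le hbdd
  intro k
  obtain ⟨u, hut, hcount, hdisj, hcov⟩ :=
    exists_vitali_subfamily ((sep_subset t _).trans ht) fun p hp => hp.2
  have hut' : u ⊆ t := hut.trans (sep_subset t _)
  have hsub : ⋃ p ∈ {p ∈ t | p.1 ≤ k}, ball p.2 p.1 ⊆ ⋃ q ∈ u, ball q.2 (5 * q.1) := by
    refine iUnion₂_subset fun p hp x hx => ?_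
    obtain ⟨q, hq, h1, h2⟩ := hcov p hp
    refine mem_biUnion hq ?_
    rw [mem_ball] at hx ⊢
    rw [← dist_eq_norm] at h2
    linarith [dist_triangle x p.2 q.2]
  calc volume (⋃ p ∈ {p ∈ t | p.1 ≤ k}, ball p.2 p.1)
      ≤ volume (⋃ q ∈ u, ball q.2 (5 * q.1)) := measure_mono hsub
    _ ≤ ∑' q : u, volume (ball (q : Pt n).2 (5 * (q : Pt n).1)) := measure_biUnion_le _ hcount _
    _ ≤ ∑' q : u, 5 ^ n * unitVol n * ν (ball (q : Pt n).2 (q : Pt n).1) := by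
        refine ENNReal.tsum_le_tsum fun q => ?_
        have hq : 0 < (q : Pt n).1 := ht (hut' q.2)
        rw [volume_ball_eq _ (by positivity), ofReal_mul_pow (by norm_num), ENNReal.ofReal_ofNat,
          ← mul_assoc, mul_comm (unitVol n : ℝ≥0∞)]
        gcongr
        exact hν _ (hut' q.2)
    _ = 5 ^ n * unitVol n * ν (⋃ q ∈ u, ball q.2 q.1) := by
        rw [measure_biUnion hcount hdisj (fun _ _ => measurableSet_ball), ENNReal.tsum_mul_left]
    _ ≤ _ := by gcongr; exact subset_univ _

end Balls

section NonTangMax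

variable {n : ℕ}

lemma le_nonTangMax (g : Pt n → ℝ≥0∞) {p : Pt n} {x : EuclideanSpace ℝ (Fin n)}
    (h : ‖p.2 - x‖ < p.1) : g p ≤ nonTangMax g x :=
  le_iSup₂ (f := fun (p : Pt n) (_ : ‖p.2 - x‖ < p.1) => g p) p h

lemma superlevel_nonTangMax (g : Pt n → ℝ≥0∞) (a : ℝ≥0∞) :
    {x | a < nonTangMax g x} = ⋃ p ∈ halfSpace n ∩ {p | a < g p}, ball p.2 p.1 := by
  ext x
  simp only [nonTangMax, mem_ofPred_eq, lt_iSup_iff, mem_iUnion, exists_prop, mem_ball',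
    mem_inter_iff, dist_eq_norm]
  exact exists_congr fun p =>
    ⟨fun h => ⟨⟨(norm_nonneg _).trans_lt h.1, h.2⟩, h.1⟩, fun h => ⟨h.2, h.1.2⟩⟩

lemma measurable_nonTangMax (g : Pt n → ℝ≥0∞) : Measurable (nonTangMax g) :=
  measurable_of_Ioi fun a => ((superlevel_nonTangMax g a).symm ▸
    isOpen_biUnion fun _ _ => isOpen_ball : IsOpen {x | a < nonTangMax g x}).measurableSet

lemma nonTangMax_sq_le (g : Pt n → ℝ≥0∞) (x : EuclideanSpace ℝ (Fin n)) :
    nonTangMax (fun p => g p ^ 2) x ≤ nonTangMax g x ^ 2 :=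
  iSup₂_le fun _ hp => pow_le_pow_left' (le_nonTangMax g hp) 2

end NonTangMax

section Maximal

variable {n : ℕ}

/-- The average `s⁻ⁿ ∫_{B(y,s)} φ`, up to the volume of the unit ball. The Hardy-Littlewood
maximal function of `φ` is `nonTangMax (ballAvg φ)`. -/
def ballAvg (φ : EuclideanSpace ℝ (Fin n) → ℝ≥0∞) (p : Pt n) : ℝ≥0∞ :=
  (ENNReal.ofReal (p.1 ^ n))⁻¹ * ∫⁻ z in ball p.2 p.1, φ z

lemma ofReal_pow_le_of_lt_ballAvg {φ : EuclideanSpace ℝ (Fin n) → ℝ≥0∞} {p : Pt n}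
    (hp : 0 < p.1) {b : ℝ≥0∞} (hb : b ≠ 0) (hb' : b ≠ ⊤) (h : 2 * unitVol n * b < ballAvg φ p) :
    ENNReal.ofReal (p.1 ^ n) ≤
      (unitVol n * b)⁻¹ * ∫⁻ z in ball p.2 p.1, {z | b < φ z}.indicator φ z := by
  set v := ENNReal.ofReal (p.1 ^ n)
  set ω := (unitVol n : ℝ≥0∞)
  have hω : ω ≠ 0 := coe_unitVol_ne_zero n
  have hle : ∀ z, φ z ≤ {z | b < φ z}.indicator φ z + b := fun z => by
    by_cases hz : b < φ z
    · exact (indicator_of_mem (show z ∈ {z | b < φ z} from hz) φ).symm ▸ le_self_add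
    · exact (not_lt.1 hz).trans le_add_self
  have hsum : ω * b * v + ω * b * v ≤
      (∫⁻ z in ball p.2 p.1, {z | b < φ z}.indicator φ z) + ω * b * v := by
    calc ω * b * v + ω * b * v = 2 * ω * b * v := by ring
      _ ≤ ballAvg φ p * v := by gcongr
      _ = ∫⁻ z in ball p.2 p.1, φ z := by
        rw [ballAvg, mul_right_comm, ENNReal.inv_mul_cancel (ofReal_pow_ne_zero hp n)
          ENNReal.ofReal_ne_top, one_mul]
      _ ≤ ∫⁻ z in ball p.2 p.1, ({z | b < φ z}.indicator φ z + b) := lintegral_mono hle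
      _ = _ := by
        rw [lintegral_add_right _ measurable_const, setLIntegral_const, volume_ball_eq _ hp]
        ring
  have hωb : ω * b ≠ ⊤ := ENNReal.mul_ne_top ENNReal.coe_ne_top hb'
  rw [mul_comm (ω * b)⁻¹, ← div_eq_mul_inv, ENNReal.le_div_iff_mul_le
    (Or.inl (mul_ne_zero hω hb)) (Or.inl hωb), mul_comm]
  exact (ENNReal.add_le_add_iff_right (ENNReal.mul_ne_top hωb ENNReal.ofReal_ne_top)).1 hsum

lemma weak_type_maximal {φ : EuclideanSpace ℝ (Fin n) → ℝ≥0∞} (hφ : Measurable φ)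
    {b : ℝ≥0∞} (hb : b ≠ 0) (hb' : b ≠ ⊤) :
    b * volume {x | 2 * unitVol n * b < nonTangMax (ballAvg φ) x} ≤
      5 ^ n * ∫⁻ z in {z | b < φ z}, φ z := by
  have hω := coe_unitVol_ne_zero n
  have hm : MeasurableSet {z | b < φ z} := measurableSet_lt measurable_const hφ
  have hcov := volume_biUnion_ball_le
    (t := halfSpace n ∩ {p | 2 * unitVol n * b < ballAvg φ p}) (fun p hp => hp.1)
    (ν := (unitVol n * b)⁻¹ • volume.withDensity ({z | b < φ z}.indicator φ)) fun p hp => by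
      rw [Measure.smul_apply, withDensity_apply _ measurableSet_ball]
      exact ofReal_pow_le_of_lt_ballAvg hp.1 hb hb' hp.2
  rw [Measure.smul_apply, withDensity_apply _ MeasurableSet.univ, Measure.restrict_univ,
    lintegral_indicator hm, ← superlevel_nonTangMax, smul_eq_mul] at hcov
  calc _ ≤ b * (5 ^ n * unitVol n * ((unitVol n * b)⁻¹ * ∫⁻ z in {z | b < φ z}, φ z)) := by gcongr
    _ = (unitVol n * b) * (unitVol n * b)⁻¹ * (5 ^ n * ∫⁻ z in {z | b < φ z}, φ z) := by ring
    _ = _ := by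
      rw [ENNReal.mul_inv_cancel (mul_ne_zero hω hb)
        (ENNReal.mul_ne_top ENNReal.coe_ne_top hb'), one_mul]

lemma mul_volume_superlevel_maximal_le {φ : EuclideanSpace ℝ (Fin n) → ℝ≥0∞} (hφ : Measurable φ)
    {t : ℝ≥0∞} (ht : t ≠ 0) (ht' : t ≠ ⊤) :
    2 * t * volume {x | t < nonTangMax (ballAvg φ) x} ≤
      4 * 5 ^ n * unitVol n * volume.withDensity φ {z | t < 2 * unitVol n * φ z} := by
  set ω := (unitVol n : ℝ≥0∞)
  have hω : 2 * ω ≠ 0 := mul_ne_zero two_ne_zero (coe_unitVol_ne_zero n)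
  have hω' : 2 * ω ≠ ⊤ := ENNReal.mul_ne_top ENNReal.ofNat_ne_top ENNReal.coe_ne_top
  obtain ⟨b, rfl⟩ : ∃ b, t = 2 * ω * b := ⟨t / (2 * ω), (ENNReal.mul_div_cancel hω hω').symm⟩
  have hb : b ≠ 0 := right_ne_zero_of_mul ht
  have hb' : b ≠ ⊤ := fun h => ht' (by rw [h, ENNReal.mul_top hω])
  have hscale : {z | 2 * ω * b < 2 * ω * φ z} = {z | b < φ z} := by
    ext z
    exact ENNReal.mul_lt_mul_iff_right hω hω'
  rw [hscale, withDensity_apply _ (measurableSet_lt measurable_const hφ)]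
  calc _ = 4 * ω * (b * volume {x | 2 * ω * b < nonTangMax (ballAvg φ) x}) := by ring
    _ ≤ 4 * ω * (5 ^ n * ∫⁻ z in {z | b < φ z}, φ z) := by
      exact mul_le_mul_right (weak_type_maximal hφ hb hb') _
    _ = _ := by ring

/-- The Hardy-Littlewood maximal theorem in `L₂`. -/
theorem lintegral_sq_maximal_le {φ : EuclideanSpace ℝ (Fin n) → ℝ≥0∞} (hφ : Measurable φ) :
    ∫⁻ x, nonTangMax (ballAvg φ) x ^ 2 ≤ 8 * 5 ^ n * unitVol n ^ 2 * ∫⁻ x, φ x ^ 2 := by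
  set ω := (unitVol n : ℝ≥0∞)
  have hω' : 2 * ω ≠ ⊤ := ENNReal.mul_ne_top ENNReal.ofNat_ne_top ENNReal.coe_ne_top
  calc ∫⁻ x, nonTangMax (ballAvg φ) x ^ 2
      = ∫⁻ t in Ioi (0 : ℝ),
          2 * ENNReal.ofReal t * volume {x | ENNReal.ofReal t < nonTangMax (ballAvg φ) x} :=
        lintegral_sq_eq_lintegral_superlevel (measurable_nonTangMax _)
    _ ≤ ∫⁻ t in Ioi (0 : ℝ), 4 * 5 ^ n * ω *
          volume.withDensity φ {z | ENNReal.ofReal t < 2 * ω * φ z} :=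
        setLIntegral_mono' measurableSet_Ioi fun t ht =>
          mul_volume_superlevel_maximal_le hφ (ENNReal.ofReal_pos.2 ht).ne' ENNReal.ofReal_ne_top
    _ = 4 * 5 ^ n * ω * ∫⁻ z, 2 * ω * φ z ∂volume.withDensity φ := by
        rw [lintegral_const_mul' _ _ (ENNReal.mul_ne_top (by finiteness) ENNReal.coe_ne_top),
          lintegral_eq_lintegral_superlevel (g := fun z => 2 * ω * φ z) (by fun_prop)]
    _ = 8 * 5 ^ n * ω ^ 2 * ∫⁻ x, φ x ^ 2 := by
        rw [lintegral_const_mul' _ _ hω', lintegral_withDensity_eq_lintegral_mul _ hφ hφ]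
        simp only [Pi.mul_apply, ← sq]
        ring

end Maximal

section Carleson

variable {n : ℕ}

/-- The tent `{(s, y) : s > 0, |y - x| < r - s}`. -/
def tent (x : EuclideanSpace ℝ (Fin n)) (r : ℝ) : Set (Pt n) :=
  {p | 0 < p.1 ∧ ‖p.2 - x‖ < r - p.1}

lemma measurableSet_tent (x : EuclideanSpace ℝ (Fin n)) (r : ℝ) : MeasurableSet (tent x r) :=
  (measurableSet_lt measurable_const measurable_fst).inter
    (measurableSet_lt (f := fun p : Pt n => ‖p.2 - x‖) (g := fun p : Pt n => r - p.1)
      (by fun_prop) (by fun_prop))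

/-- `μ` is a Carleson measure with constant `K`, tested on tents rather than on cylinders. -/
def IsCarleson (μ : Measure (Pt n)) (K : ℝ≥0∞) : Prop :=
  ∀ x r, 0 < r → μ (tent x r) ≤ K * ENNReal.ofReal (r ^ n)

lemma IsCarleson.measure_le {μ : Measure (Pt n)} {K : ℝ≥0∞} (hμ : IsCarleson μ K)
    {t : Set (Pt n)} (ht : t ⊆ halfSpace n) :
    μ t ≤ K * (6 ^ n * (unitVol n : ℝ≥0∞)⁻¹) * volume (⋃ p ∈ t, ball p.2 p.1) := by
  have hω := coe_unitVol_ne_zero n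
  suffices hbdd : ∀ k : ℕ, μ {p ∈ t | p.1 ≤ k} ≤
      K * (6 ^ n * (unitVol n : ℝ≥0∞)⁻¹) * volume (⋃ p ∈ t, ball p.2 p.1) by
    conv_lhs => rw [← iUnion_sep_fst_le t, (monotone_sep_fst_le t).measure_iUnion]
    exact iSup_le hbdd
  intro k
  obtain ⟨u, hut, hcount, hdisj, hcov⟩ :=
    exists_vitali_subfamily ((sep_subset t _).trans ht) fun p hp => hp.2
  have hut' : u ⊆ t := hut.trans (sep_subset t _)
  have hsub : {p ∈ t | p.1 ≤ k} ⊆ ⋃ q ∈ u, tent q.2 (6 * q.1) := by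
    intro p hp
    obtain ⟨q, hq, h1, h2⟩ := hcov p hp
    have hq0 : 0 < q.1 := ht (hut' hq)
    exact mem_biUnion hq ⟨ht hp.1, by linarith⟩
  calc μ {p ∈ t | p.1 ≤ k} ≤ μ (⋃ q ∈ u, tent q.2 (6 * q.1)) := measure_mono hsub
    _ ≤ ∑' q : u, μ (tent (q : Pt n).2 (6 * (q : Pt n).1)) := measure_biUnion_le _ hcount _
    _ ≤ ∑' q : u, K * (6 ^ n * (unitVol n : ℝ≥0∞)⁻¹) *
          volume (ball (q : Pt n).2 (q : Pt n).1) := by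
        refine ENNReal.tsum_le_tsum fun q => ?_
        have hq : 0 < (q : Pt n).1 := ht (hut' q.2)
        rw [volume_ball_eq _ hq, mul_assoc, mul_assoc, ← mul_assoc (unitVol n : ℝ≥0∞)⁻¹,
          ENNReal.inv_mul_cancel hω ENNReal.coe_ne_top, one_mul]
        simpa only [ofReal_mul_pow (show (0 : ℝ) ≤ 6 by norm_num), ENNReal.ofReal_ofNat] using
          hμ _ _ (show 0 < 6 * (q : Pt n).1 by positivity)
    _ = K * (6 ^ n * (unitVol n : ℝ≥0∞)⁻¹) * volume (⋃ q ∈ u, ball q.2 q.1) := by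
        rw [measure_biUnion hcount hdisj (fun _ _ => measurableSet_ball), ENNReal.tsum_mul_left]
    _ ≤ _ := by exact mul_le_mul_right (measure_mono (biUnion_subset_biUnion_left hut')) _

theorem IsCarleson.lintegral_le {μ : Measure (Pt n)} [SFinite μ] {K : ℝ≥0∞}
    (hμ : IsCarleson μ K) {g : Pt n → ℝ≥0∞} (hg : Measurable g) :
    ∫⁻ p in halfSpace n, g p ∂μ ≤
      K * (6 ^ n * (unitVol n : ℝ≥0∞)⁻¹) * ∫⁻ x, nonTangMax g x := by
  have hlevel : Measurable fun t : ℝ => volume {x | ENNReal.ofReal t < nonTangMax g x} :=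
    Antitone.measurable fun s t hst => measure_mono fun x hx =>
      (ENNReal.ofReal_le_ofReal hst).trans_lt hx
  rw [lintegral_eq_lintegral_superlevel hg,
    lintegral_eq_lintegral_superlevel (measurable_nonTangMax g), ← lintegral_const_mul _ hlevel]
  refine lintegral_mono fun t => ?_
  rw [Measure.restrict_apply (measurableSet_lt measurable_const hg), superlevel_nonTangMax,
    inter_comm]
  exact hμ.measure_le inter_subset_left

end Carleson

section AreaAndCarleson

variable {n : ℕ}

lemma measurableSet_halfSpace (n : ℕ) : MeasurableSet (halfSpace n) :=
  measurableSet_lt measurable_const measurable_fst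

lemma measurableSet_coneRel (n : ℕ) :
    MeasurableSet {z : EuclideanSpace ℝ (Fin n) × Pt n | ‖z.2.2 - z.1‖ < z.2.1} :=
  measurableSet_lt (by fun_prop) (by fun_prop)

lemma measurable_areaFun {g : Pt n → ℝ≥0∞} (hg : Measurable g) : Measurable (areaFun g) :=
  measurable_lintegral_preimage_mk (measurableSet_coneRel n)
    (f := fun z => g z.2 * (ENNReal.ofReal (z.2.1 ^ n))⁻¹) (by fun_prop)

lemma measurable_ballAvg {φ : EuclideanSpace ℝ (Fin n) → ℝ≥0∞} (hφ : Measurable φ) :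
    Measurable (ballAvg φ) := by
  have hrel : MeasurableSet {z : Pt n × EuclideanSpace ℝ (Fin n) | dist z.2 z.1.2 < z.1.1} :=
    measurableSet_lt (by fun_prop) (by fun_prop)
  exact Measurable.mul (by fun_prop)
    (measurable_lintegral_preimage_mk hrel (f := fun z => φ z.2) (by fun_prop))

/-- `A` is dual to the ball averages. -/
lemma lintegral_areaFun_mul {g : Pt n → ℝ≥0∞} (hg : Measurable g)
    {φ : EuclideanSpace ℝ (Fin n) → ℝ≥0∞} (hφ : Measurable φ) :
    ∫⁻ x, areaFun g x * φ x = ∫⁻ p, g p * ballAvg φ p := by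
  calc ∫⁻ x, areaFun g x * φ x
      = ∫⁻ x, ∫⁻ p in {p : Pt n | ‖p.2 - x‖ < p.1},
          g p * (ENNReal.ofReal (p.1 ^ n))⁻¹ * φ x :=
        lintegral_congr fun x => (lintegral_mul_const _ (by fun_prop)).symm
    _ = ∫⁻ p : Pt n, ∫⁻ x in {x | ‖p.2 - x‖ < p.1},
          g p * (ENNReal.ofReal (p.1 ^ n))⁻¹ * φ x :=
        lintegral_lintegral_preimage_mk (measurableSet_coneRel n)
          (f := fun z => g z.2 * (ENNReal.ofReal (z.2.1 ^ n))⁻¹ * φ z.1) (by fun_prop)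
    _ = ∫⁻ p, g p * ballAvg φ p := by
        refine lintegral_congr fun p => ?_
        have hball : {x | ‖p.2 - x‖ < p.1} = ball p.2 p.1 := by
          ext x; rw [mem_ball', dist_eq_norm, mem_ofPred_eq]
        rw [lintegral_const_mul _ hφ, hball, ballAvg, mul_assoc]

lemma lintegral_tent_le_lintegral_areaFun {g : Pt n → ℝ≥0∞} (hg : Measurable g)
    (x : EuclideanSpace ℝ (Fin n)) (r : ℝ) :
    unitVol n * ∫⁻ p in tent x r, g p ≤ ∫⁻ z in ball x r, areaFun g z := by
  have hball : ∀ p ∈ tent x r, unitVol n ≤ ballAvg ((ball x r).indicator 1) p := by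
    rintro p ⟨hp0, hp⟩
    have hsub : ball p.2 p.1 ⊆ ball x r := ball_subset_ball' (by rw [dist_eq_norm]; linarith)
    rw [ballAvg, lintegral_indicator_one measurableSet_ball,
      Measure.restrict_apply measurableSet_ball, inter_eq_self_of_subset_right hsub,
      volume_ball_eq _ hp0, mul_left_comm, ENNReal.inv_mul_cancel (ofReal_pow_ne_zero hp0 n)
      ENNReal.ofReal_ne_top, mul_one]
  calc unitVol n * ∫⁻ p in tent x r, g p = ∫⁻ p in tent x r, unitVol n * g p :=
        (lintegral_const_mul _ hg).symm
    _ ≤ ∫⁻ p in tent x r, g p * ballAvg ((ball x r).indicator 1) p :=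
        setLIntegral_mono' (measurableSet_tent x r) fun p hp => by
          rw [mul_comm]; gcongr; exact hball p hp
    _ ≤ ∫⁻ p, g p * ballAvg ((ball x r).indicator 1) p := setLIntegral_le_lintegral _ _
    _ = ∫⁻ z, areaFun g z * (ball x r).indicator 1 z :=
        (lintegral_areaFun_mul hg (measurable_one.indicator measurableSet_ball)).symm
    _ = ∫⁻ z in ball x r, areaFun g z := by
        rw [← lintegral_indicator measurableSet_ball]
        exact lintegral_congr fun z => by simp [indicator]

lemma carlesonFun_le_maximal {g : Pt n → ℝ≥0∞} (hg : Measurable g)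
    (x : EuclideanSpace ℝ (Fin n)) :
    carlesonFun g x ≤ (unitVol n : ℝ≥0∞)⁻¹ * nonTangMax (ballAvg (areaFun g)) x := by
  have hω := coe_unitVol_ne_zero n
  refine iSup₂_le fun r hr => ?_
  change (ENNReal.ofReal (r ^ n))⁻¹ * ∫⁻ p in tent x r, g p ≤ _
  rw [mul_comm (unitVol n : ℝ≥0∞)⁻¹, ← div_eq_mul_inv,
    ENNReal.le_div_iff_mul_le (Or.inl hω) (Or.inl ENNReal.coe_ne_top)]
  calc _ = (ENNReal.ofReal (r ^ n))⁻¹ * (unitVol n * ∫⁻ p in tent x r, g p) := by ring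
    _ ≤ ballAvg (areaFun g) (r, x) := by
        rw [ballAvg]; gcongr; exact lintegral_tent_le_lintegral_areaFun hg x r
    _ ≤ _ := le_nonTangMax _ (by simpa using hr)

lemma lintegral_tent_le_carlesonFun (g : Pt n → ℝ≥0∞) (x : EuclideanSpace ℝ (Fin n)) {r : ℝ}
    (hr : 0 < r) :
    ∫⁻ p in tent x r, g p ≤ carlesonFun g x * ENNReal.ofReal (r ^ n) := by
  rw [← ENNReal.div_le_iff (ofReal_pow_ne_zero hr n) ENNReal.ofReal_ne_top, div_eq_mul_inv,
    mul_comm]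
  exact le_iSup₂ (f := fun (r : ℝ) (_ : 0 < r) =>
    (ENNReal.ofReal (r ^ n))⁻¹ * ∫⁻ p in tent x r, g p) r hr

lemma tent_subset_tent {x z : EuclideanSpace ℝ (Fin n)} {r R : ℝ} (h : ‖x - z‖ + r ≤ R) :
    tent x r ⊆ tent z R := fun p hp =>
  ⟨hp.1, by linarith [hp.2, norm_sub_le_norm_sub_add_norm_sub p.2 x z]⟩

lemma isCarleson_withDensity_iff {g : Pt n → ℝ≥0∞} {K : ℝ≥0∞} :
    IsCarleson (volume.withDensity g) K ↔
      ∀ x r, 0 < r → ∫⁻ p in tent x r, g p ≤ K * ENNReal.ofReal (r ^ n) :=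
  forall₃_congr fun x r _ => by rw [withDensity_apply _ (measurableSet_tent x r)]

lemma isCarleson_eLpNorm_carlesonFun (g : Pt n → ℝ≥0∞) :
    IsCarleson (volume.withDensity g) (2 ^ n * eLpNorm (carlesonFun g) ⊤ volume) := by
  refine isCarleson_withDensity_iff.2 fun x r hr => ?_
  have hball : ∃ᵐ z, z ∈ ball x r := frequently_ae_iff.2 (measure_ball_pos volume x hr).ne'
  obtain ⟨z, hzr, hz⟩ := (hball.and_eventually
    (ENNReal.ae_le_essSup (μ := volume) (carlesonFun g))).exists
  rw [mem_ball', dist_eq_norm] at hzr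
  calc ∫⁻ p in tent x r, g p ≤ ∫⁻ p in tent z (2 * r), g p :=
        lintegral_mono_set (tent_subset_tent (by linarith))
    _ ≤ carlesonFun g z * ENNReal.ofReal ((2 * r) ^ n) :=
        lintegral_tent_le_carlesonFun g z (by positivity)
    _ ≤ eLpNorm (carlesonFun g) ⊤ volume * ENNReal.ofReal ((2 * r) ^ n) := by
        rw [eLpNorm_exponent_top]; gcongr; exact hz
    _ = _ := by rw [ofReal_mul_pow zero_le_two, ENNReal.ofReal_ofNat]; ring

lemma eLpNorm_carlesonFun_le {g : Pt n → ℝ≥0∞} {K : ℝ≥0∞}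
    (hg : IsCarleson (volume.withDensity g) K) : eLpNorm (carlesonFun g) ⊤ volume ≤ K := by
  rw [eLpNorm_exponent_top]
  refine essSup_le_of_ae_le _ (Eventually.of_forall fun x => iSup₂_le fun r hr => ?_)
  rw [mul_comm, ← div_eq_mul_inv, ENNReal.div_le_iff (ofReal_pow_ne_zero hr n)
    ENNReal.ofReal_ne_top]
  exact isCarleson_withDensity_iff.1 hg x r hr

end AreaAndCarleson

section Whitney

variable {n : ℕ}

lemma mem_whitney_iff {p q : Pt n} :
    p ∈ whitney q ↔ q.1 / 2 < p.1 ∧ p.1 < 2 * q.1 ∧ ‖p.2 - q.2‖ < q.1 := by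
  rw [whitney, mem_ofPred_eq]
  rcases le_or_gt q.1 0 with hq | hq
  · have hnorm : ¬ ‖p.2 - q.2‖ < q.1 := not_lt.2 (hq.trans (norm_nonneg _))
    simp only [hnorm, and_false]
  · rw [lt_div_iff₀ hq, div_lt_iff₀ hq, one_div, inv_mul_eq_div]

lemma base_pos_of_mem_whitney {p q : Pt n} (h : p ∈ whitney q) : 0 < q.1 :=
  (norm_nonneg _).trans_lt (mem_whitney_iff.1 h).2.2

lemma whitney_subset_halfSpace (q : Pt n) : whitney q ⊆ halfSpace n := fun _ hp =>
  (half_pos (base_pos_of_mem_whitney hp)).trans (mem_whitney_iff.1 hp).1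

lemma whitney_eq_empty {q : Pt n} (hq : q.1 ≤ 0) : whitney q = ∅ :=
  eq_empty_of_forall_notMem fun _ hp => (base_pos_of_mem_whitney hp).not_ge hq

lemma measurableSet_whitneyRel (n : ℕ) : MeasurableSet {z : Pt n × Pt n | z.2 ∈ whitney z.1} := by
  simp_rw [mem_whitney_iff]
  have hlower : MeasurableSet {z : Pt n × Pt n | z.1.1 / 2 < z.2.1} :=
    measurableSet_lt (by fun_prop) (by fun_prop)
  have hupper : MeasurableSet {z : Pt n × Pt n | z.2.1 < 2 * z.1.1} :=
    measurableSet_lt (by fun_prop) (by fun_prop)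
  have hball : MeasurableSet {z : Pt n × Pt n | ‖z.2.2 - z.1.2‖ < z.1.1} :=
    measurableSet_lt (by fun_prop) (by fun_prop)
  exact hlower.inter (hupper.inter hball)

lemma measurableSet_whitney (q : Pt n) : MeasurableSet (whitney q) :=
  measurable_prodMk_left (measurableSet_whitneyRel n)

lemma restrict_whitney_le (q : Pt n) : volume.restrict (whitney q) ≤ halfVol n :=
  Measure.restrict_mono (whitney_subset_halfSpace q) le_rfl

lemma volume_Ioo_prod_ball (a b : ℝ) (x : EuclideanSpace ℝ (Fin n)) {r : ℝ} (hr : 0 < r) :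
    (volume : Measure (Pt n)) (Ioo a b ×ˢ ball x r) =
      unitVol n * (ENNReal.ofReal (b - a) * ENNReal.ofReal (r ^ n)) := by
  rw [Measure.volume_eq_prod, Measure.prod_prod, Real.volume_Ioo, volume_ball_eq _ hr,
    mul_left_comm]

lemma volume_setOf_whitney_inter_nonempty_le {z : Pt n} (hz : 0 < z.1) :
    volume {q | (whitney q ∩ whitney z).Nonempty} ≤
      5 ^ (n + 1) * unitVol n * ENNReal.ofReal (z.1 ^ (n + 1)) := by
  have hsub : {q | (whitney q ∩ whitney z).Nonempty} ⊆
      Ioo 0 (5 * z.1) ×ˢ ball z.2 (5 * z.1) := by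
    rintro q ⟨p, hpq, hpz⟩
    have hq0 := base_pos_of_mem_whitney hpq
    obtain ⟨h1, -, h3⟩ := mem_whitney_iff.1 hpq
    obtain ⟨-, h5, h6⟩ := mem_whitney_iff.1 hpz
    refine ⟨⟨hq0, by linarith⟩, ?_⟩
    rw [mem_ball_iff_norm]
    rw [norm_sub_rev] at h3
    linarith [norm_sub_le_norm_sub_add_norm_sub q.2 p.2 z.2]
  calc _ ≤ _ := measure_mono hsub
    _ = unitVol n * ENNReal.ofReal ((5 * z.1) ^ (n + 1)) := by
        rw [volume_Ioo_prod_ball _ _ _ (by positivity), sub_zero,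
          ← ENNReal.ofReal_mul (by positivity), ← pow_succ']
    _ = _ := by rw [ofReal_mul_pow (by norm_num), ENNReal.ofReal_ofNat]; ring

end Whitney

section WhitneyEssSup

variable {n : ℕ}

lemma lt_essSup_iff {α : Type*} [MeasurableSpace α] {μ : Measure α} {f : α → ℝ≥0∞} {a : ℝ≥0∞} :
    a < essSup f μ ↔ μ {x | a < f x} ≠ 0 := by
  rw [← not_iff_not, not_lt, not_not]
  have hae : (∀ᵐ x ∂μ, f x ≤ a) ↔ μ {x | a < f x} = 0 := by simp only [ae_iff, not_le]
  rw [← hae]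
  exact ⟨fun h => (ENNReal.ae_le_essSup f).mono fun x hx => hx.trans h, essSup_le_of_ae_le a⟩

/-- The `L_∞` Whitney average of a `[0,∞]`-valued function. -/
def whitneyEssSup (H : Pt n → ℝ≥0∞) (q : Pt n) : ℝ≥0∞ := essSup H (volume.restrict (whitney q))

lemma whitneyEssSup_of_nonpos (H : Pt n → ℝ≥0∞) {q : Pt n} (hq : q.1 ≤ 0) :
    whitneyEssSup H q = 0 := by
  rw [whitneyEssSup, whitney_eq_empty hq, Measure.restrict_empty, essSup_measure_zero,
    bot_eq_zero]

lemma lt_whitneyEssSup_iff {H : Pt n → ℝ≥0∞} (hH : Measurable H) {q : Pt n} {a : ℝ≥0∞} :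
    a < whitneyEssSup H q ↔ volume (whitney q ∩ {p | a < H p}) ≠ 0 := by
  rw [whitneyEssSup, lt_essSup_iff,
    Measure.restrict_apply (measurableSet_lt measurable_const hH), inter_comm]

lemma measurable_whitneyEssSup {H : Pt n → ℝ≥0∞} (hH : Measurable H) :
    Measurable (whitneyEssSup H) := by
  refine measurable_of_Ioi fun a => ?_
  have hS : MeasurableSet {p | a < H p} := measurableSet_lt measurable_const hH
  have hmeas : Measurable fun q : Pt n => volume (Prod.mk q ⁻¹'
      ({z : Pt n × Pt n | z.2 ∈ whitney z.1} ∩ Prod.snd ⁻¹' {p | a < H p})) :=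
    measurable_measure_prodMk_left ((measurableSet_whitneyRel n).inter (measurable_snd hS))
  have hpre : whitneyEssSup H ⁻¹' Ioi a = {q | volume (Prod.mk q ⁻¹'
      ({z : Pt n × Pt n | z.2 ∈ whitney z.1} ∩ Prod.snd ⁻¹' {p | a < H p})) ≠ 0} :=
    Set.ext fun q => lt_whitneyEssSup_iff hH
  rw [hpre]
  exact (hmeas (measurableSet_singleton 0)).compl

end WhitneyEssSup

section WhitneyAverage

variable {n : ℕ}

/-- The `L_1` Whitney average `t^{-(1+n)} ∫_{W(t,x)} Φ`, so that `(W_2 f)²` is the average of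
`|f|²`. -/
def whitneyAvg (Φ : Pt n → ℝ≥0∞) (q : Pt n) : ℝ≥0∞ :=
  (ENNReal.ofReal (q.1 ^ (n + 1)))⁻¹ * ∫⁻ p in whitney q, Φ p

lemma whitneyAvg_of_nonpos (Φ : Pt n → ℝ≥0∞) {q : Pt n} (hq : q.1 ≤ 0) : whitneyAvg Φ q = 0 := by
  rw [whitneyAvg, whitney_eq_empty hq, setLIntegral_empty, mul_zero]

lemma whitneyAvg_mono {Φ Ψ : Pt n → ℝ≥0∞} {q : Pt n} (h : ∀ p ∈ whitney q, Φ p ≤ Ψ p) :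
    whitneyAvg Φ q ≤ whitneyAvg Ψ q :=
  mul_le_mul_right (setLIntegral_mono' (measurableSet_whitney q) h) _

lemma measurable_whitneyAvg {Φ : Pt n → ℝ≥0∞} (hΦ : Measurable Φ) : Measurable (whitneyAvg Φ) :=
  Measurable.mul (by fun_prop) (measurable_lintegral_preimage_mk (measurableSet_whitneyRel n)
    (f := fun z => Φ z.2) (by fun_prop))

lemma whitneyAvg_eq_zero {Φ : Pt n → ℝ≥0∞} {q : Pt n}
    (h : ∀ p ∈ whitney q, Φ p = 0) : whitneyAvg Φ q = 0 := by
  rw [whitneyAvg, setLIntegral_congr_fun (measurableSet_whitney q) h, lintegral_zero, mul_zero]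

lemma whitneyTwo_sq {F : Type*} [NormedAddCommGroup F] (f : Pt n → F) (q : Pt n) :
    whitneyTwo f q ^ 2 = whitneyAvg (fun p => ‖f p‖ₑ ^ 2) q := by
  rcases le_or_gt q.1 0 with hq | hq
  · simp [whitneyTwo, whitneyAvg_of_nonpos _ hq, whitney_eq_empty hq]
  · rw [whitneyTwo, mul_pow, eLpNorm_two_sq, whitneyAvg, ← ENNReal.ofReal_pow (by positivity),
      ← ENNReal.ofReal_inv_of_pos (by positivity), ← Real.rpow_natCast (q.1 ^ _),
      ← Real.rpow_mul hq.le, ← Real.rpow_natCast q.1, ← Real.rpow_neg hq.le]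
    congr 3
    push_cast
    ring_nf

lemma measurable_whitneyTwo {F : Type*} [NormedAddCommGroup F] {f : Pt n → F}
    (hf : Measurable fun p => ‖f p‖ₑ) : Measurable (whitneyTwo f) := by
  have hroot : whitneyTwo f = fun q => (whitneyAvg (fun p => ‖f p‖ₑ ^ 2) q) ^ (1 / 2 : ℝ) := by
    funext q
    rw [← whitneyTwo_sq, ← ENNReal.rpow_two, ← ENNReal.rpow_mul]
    norm_num
  rw [hroot]
  exact (measurable_whitneyAvg (hf.pow_const 2)).pow_const _

lemma whitneyAvg_mul_sq_le {Φ Ψ : Pt n → ℝ≥0∞} (hΦ : Measurable Φ) (hΨ : Measurable Ψ)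
    (q : Pt n) :
    whitneyAvg (fun p => Φ p * Ψ p) q ^ 2 ≤
      whitneyAvg (fun p => Φ p ^ 2) q * whitneyAvg (fun p => Ψ p ^ 2) q := by
  rw [whitneyAvg, mul_pow]
  calc _ ≤ (ENNReal.ofReal (q.1 ^ (n + 1)))⁻¹ ^ 2 *
        ((∫⁻ p in whitney q, Φ p ^ 2) * ∫⁻ p in whitney q, Ψ p ^ 2) := by
        gcongr; exact lintegral_mul_sq_le hΦ.aemeasurable hΨ.aemeasurable
    _ = _ := by rw [whitneyAvg, whitneyAvg]; ring

lemma whitneyAvg_mul_le (H : Pt n → ℝ≥0∞) {Φ : Pt n → ℝ≥0∞} (hΦ : Measurable Φ) (q : Pt n) :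
    whitneyAvg (fun p => H p * Φ p) q ≤ whitneyEssSup H q * whitneyAvg Φ q := by
  unfold whitneyAvg whitneyEssSup
  rw [mul_left_comm, ← lintegral_const_mul _ hΦ]
  refine mul_le_mul_right (lintegral_mono_ae ?_) _
  filter_upwards [ENNReal.ae_le_essSup (μ := volume.restrict (whitney q)) H] with p hp
  gcongr

/-- The mass `∬_{q : p ∈ W(q)} q₁^{-(1+n)} dq` that the Whitney averages give to the point `p`. -/
def whitneyMass (p : Pt n) : ℝ≥0∞ :=
  ∫⁻ q in {q | p ∈ whitney q}, (ENNReal.ofReal (q.1 ^ (n + 1)))⁻¹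

lemma lintegral_whitneyAvg {Φ : Pt n → ℝ≥0∞} (hΦ : Measurable Φ) :
    ∫⁻ q, whitneyAvg Φ q = ∫⁻ p, whitneyMass p * Φ p := by
  calc ∫⁻ q, whitneyAvg Φ q
      = ∫⁻ q : Pt n, ∫⁻ p in whitney q, (ENNReal.ofReal (q.1 ^ (n + 1)))⁻¹ * Φ p :=
        lintegral_congr fun q => (lintegral_const_mul _ hΦ).symm
    _ = ∫⁻ p : Pt n, ∫⁻ q in {q | p ∈ whitney q}, (ENNReal.ofReal (q.1 ^ (n + 1)))⁻¹ * Φ p :=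
        lintegral_lintegral_preimage_mk (measurableSet_whitneyRel n)
          (f := fun z => (ENNReal.ofReal (z.1.1 ^ (n + 1)))⁻¹ * Φ z.2) (by fun_prop)
    _ = _ := lintegral_congr fun p => lintegral_mul_const _ (by fun_prop)

lemma le_whitneyMass {p : Pt n} (hp : 0 < p.1) :
    (2 ^ (n + 1))⁻¹ * unitVol n ≤ whitneyMass p := by
  have hsub : Ioo p.1 (2 * p.1) ×ˢ ball p.2 p.1 ⊆ {q | p ∈ whitney q} := by
    rintro q ⟨⟨h1, h2⟩, h3⟩
    rw [mem_ball', dist_eq_norm] at h3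
    exact mem_whitney_iff.2 ⟨by linarith, by linarith, by linarith⟩
  have hpow := ofReal_pow_ne_zero hp (n + 1)
  calc _ = (ENNReal.ofReal ((2 * p.1) ^ (n + 1)))⁻¹ *
          (unitVol n * ENNReal.ofReal (p.1 ^ (n + 1))) := by
        rw [ofReal_mul_pow zero_le_two, ENNReal.ofReal_ofNat,
          ENNReal.mul_inv (Or.inr ENNReal.ofReal_ne_top) (Or.inr hpow),
          mul_mul_mul_comm, ENNReal.inv_mul_cancel hpow ENNReal.ofReal_ne_top, mul_one]
    _ = ∫⁻ _ in Ioo p.1 (2 * p.1) ×ˢ ball p.2 p.1,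
          (ENNReal.ofReal ((2 * p.1) ^ (n + 1)))⁻¹ := by
        rw [setLIntegral_const, volume_Ioo_prod_ball _ _ _ hp, ← ENNReal.ofReal_mul (by linarith),
          show (2 * p.1 - p.1) * p.1 ^ n = p.1 ^ (n + 1) by ring]
    _ ≤ ∫⁻ q in Ioo p.1 (2 * p.1) ×ˢ ball p.2 p.1, (ENNReal.ofReal (q.1 ^ (n + 1)))⁻¹ := by
        refine setLIntegral_mono' (measurableSet_Ioo.prod measurableSet_ball) ?_
        rintro q ⟨⟨h1, h2⟩, -⟩
        have hq : 0 < q.1 := hp.trans h1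
        gcongr
    _ ≤ _ := lintegral_mono_set hsub

lemma whitneyMass_le {p : Pt n} (hp : 0 < p.1) : whitneyMass p ≤ 4 ^ (n + 1) * unitVol n := by
  have hsub : {q | p ∈ whitney q} ⊆ Ioo (p.1 / 2) (2 * p.1) ×ˢ ball p.2 (2 * p.1) := by
    intro q hq
    obtain ⟨h1, h2, h3⟩ := mem_whitney_iff.1 hq
    refine ⟨⟨by linarith, by linarith⟩, ?_⟩
    rw [mem_ball', dist_eq_norm]
    linarith
  have hpow := ofReal_pow_ne_zero (half_pos hp) (n + 1)
  calc whitneyMass p ≤ ∫⁻ q in Ioo (p.1 / 2) (2 * p.1) ×ˢ ball p.2 (2 * p.1),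
        (ENNReal.ofReal (q.1 ^ (n + 1)))⁻¹ := lintegral_mono_set hsub
    _ ≤ ∫⁻ _ in Ioo (p.1 / 2) (2 * p.1) ×ˢ ball p.2 (2 * p.1),
        (ENNReal.ofReal ((p.1 / 2) ^ (n + 1)))⁻¹ := by
        refine setLIntegral_mono' (measurableSet_Ioo.prod measurableSet_ball) ?_
        rintro q ⟨⟨h1, -⟩, -⟩
        gcongr
    _ ≤ (ENNReal.ofReal ((p.1 / 2) ^ (n + 1)))⁻¹ *
          (unitVol n * ENNReal.ofReal ((4 * (p.1 / 2)) ^ (n + 1))) := by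
        rw [setLIntegral_const, volume_Ioo_prod_ball _ _ _ (by positivity),
          ← ENNReal.ofReal_mul (by linarith), show 4 * (p.1 / 2) = 2 * p.1 by ring,
          pow_succ' (2 * p.1)]
        gcongr
        linarith
    _ = _ := by
        rw [ofReal_mul_pow (by norm_num), ENNReal.ofReal_ofNat, mul_comm, mul_assoc, mul_assoc,
          ENNReal.mul_inv_cancel hpow ENNReal.ofReal_ne_top, mul_one, mul_comm]

lemma lintegral_halfVol_le_lintegral_whitneyAvg {Φ : Pt n → ℝ≥0∞} (hΦ : Measurable Φ) :
    ∫⁻ p, Φ p ∂(halfVol n) ≤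
      2 ^ (n + 1) * (unitVol n : ℝ≥0∞)⁻¹ * ∫⁻ q, whitneyAvg Φ q := by
  have hω := coe_unitVol_ne_zero n
  have hconst : 2 ^ (n + 1) * (unitVol n : ℝ≥0∞)⁻¹ * ((2 ^ (n + 1))⁻¹ * unitVol n) = 1 := by
    rw [mul_mul_mul_comm, ENNReal.mul_inv_cancel (by positivity)
      (ENNReal.pow_ne_top ENNReal.ofNat_ne_top), ENNReal.inv_mul_cancel hω ENNReal.coe_ne_top,
      one_mul]
  calc ∫⁻ p, Φ p ∂(halfVol n)
      = 2 ^ (n + 1) * (unitVol n : ℝ≥0∞)⁻¹ *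
          ∫⁻ p, (2 ^ (n + 1))⁻¹ * unitVol n * Φ p ∂(halfVol n) := by
        rw [lintegral_const_mul _ hΦ, ← mul_assoc, hconst, one_mul]
    _ ≤ 2 ^ (n + 1) * (unitVol n : ℝ≥0∞)⁻¹ * ∫⁻ p, whitneyMass p * Φ p ∂(halfVol n) := by
        refine mul_le_mul_right
          (setLIntegral_mono' (measurableSet_halfSpace n) fun p hp => ?_) _
        gcongr
        exact le_whitneyMass hp
    _ ≤ _ := by rw [lintegral_whitneyAvg hΦ]; gcongr; exact Measure.restrict_le_self

lemma lintegral_whitneyAvg_le {Φ : Pt n → ℝ≥0∞} (hΦ : Measurable Φ) :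
    ∫⁻ q, whitneyAvg Φ q ≤ 4 ^ (n + 1) * unitVol n * ∫⁻ p, Φ p ∂(halfVol n) := by
  have hsupp : Function.support (fun p => whitneyMass p * Φ p) ⊆ halfSpace n := by
    intro p hp
    by_contra hp'
    refine hp ?_
    have : {q : Pt n | p ∈ whitney q} = ∅ :=
      eq_empty_of_forall_notMem fun q hq => hp' (whitney_subset_halfSpace q hq)
    simp only [whitneyMass, this, setLIntegral_empty, zero_mul]
  rw [lintegral_whitneyAvg hΦ, ← setLIntegral_eq_of_support_subset hsupp,
    ← lintegral_const_mul _ hΦ]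
  refine setLIntegral_mono' (measurableSet_halfSpace n) fun p hp => ?_
  gcongr
  exact whitneyMass_le hp

end WhitneyAverage

section Norms

variable {n m : ℕ}

lemma normN_sq (f : Pt n → Val n m) : normN f ^ 2 = ∫⁻ x, nonTangMax (whitneyTwo f) x ^ 2 :=
  eLpNorm_two_sq _ _

lemma normC_sq (f : Pt n → Val n m) : normC f ^ 2 = ∫⁻ x, carlesonFun (whitneyTwo f) x ^ 2 :=
  eLpNorm_two_sq _ _

lemma normA_sq (f : Pt n → Val n m) : normA f ^ 2 = ∫⁻ x, areaFun (whitneyTwo f) x ^ 2 :=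
  eLpNorm_two_sq _ _

lemma normL2_one_sq (f : Pt n → Val n m) :
    normL2 1 f ^ 2 = ∫⁻ p, ‖f p‖ₑ ^ 2 * ENNReal.ofReal p.1 ∂(halfVol n) := by
  simp only [normL2, rpow_half_sq, Real.rpow_one]

/-- The density `|u|²/t`. -/
def density {F : Type*} [NormedAddCommGroup F] (u : Pt n → F) (p : Pt n) : ℝ≥0∞ :=
  ‖u p‖ₑ ^ 2 / ENNReal.ofReal p.1

lemma measurable_density {F : Type*} [NormedAddCommGroup F] {u : Pt n → F}
    (hu : Measurable fun p => ‖u p‖ₑ) : Measurable (density u) :=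
  (hu.pow_const 2).div (by fun_prop)

lemma density_mul {F : Type*} [NormedAddCommGroup F] (u : Pt n → F) {p : Pt n}
    (hp : p ∈ halfSpace n) : density u p * ENNReal.ofReal p.1 = ‖u p‖ₑ ^ 2 :=
  ENNReal.div_mul_cancel (ENNReal.ofReal_pos.2 hp).ne' ENNReal.ofReal_ne_top

lemma normL2_neg_one_sq (f : Pt n → Val n m) :
    normL2 (-1) f ^ 2 = ∫⁻ p, density f p ∂(halfVol n) := by
  rw [normL2, rpow_half_sq]
  refine setLIntegral_congr_fun (measurableSet_halfSpace n) fun p hp => ?_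
  simp only [density, Real.rpow_neg_one, ENNReal.ofReal_inv_of_pos (show 0 < p.1 from hp),
    div_eq_mul_inv]

lemma whitneySup_sq_norm_div (E : Pt n → (Val n m →L[ℂ] Val n m)) :
    (whitneySup fun p : Pt n => ‖E p‖ ^ 2 / p.1) = whitneyEssSup (density E) := by
  funext q
  rw [whitneySup, eLpNorm_exponent_top]
  refine essSup_congr_ae (ae_restrict_of_forall_mem (measurableSet_whitney q) fun p hp => ?_)
  have hp : 0 < p.1 := whitney_subset_halfSpace q hp
  beta_reduce
  rw [density, Real.enorm_of_nonneg (by positivity), ENNReal.ofReal_div_of_pos hp,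
    ENNReal.ofReal_pow (norm_nonneg _), ofReal_norm]

lemma carlesonDahlberg_sq (E : Pt n → (Val n m →L[ℂ] Val n m)) :
    carlesonDahlberg E ^ 2 = eLpNorm (carlesonFun (whitneyEssSup (density E))) ⊤ volume := by
  rw [carlesonDahlberg, rpow_half_sq, whitneySup_sq_norm_div]

lemma stronglyMeasurable_mult {E : Pt n → (Val n m →L[ℂ] Val n m)} (hE : StronglyMeasurable E)
    {f : Pt n → Val n m} (hf : StronglyMeasurable f) : StronglyMeasurable (mult E f) :=
  isBoundedBilinearMap_apply.continuous.comp_stronglyMeasurable (hE.prodMk hf)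

lemma enorm_mult_sq_le (E : Pt n → (Val n m →L[ℂ] Val n m)) (f : Pt n → Val n m) (p : Pt n) :
    ‖mult E f p‖ₑ ^ 2 ≤ ‖E p‖ₑ ^ 2 * ‖f p‖ₑ ^ 2 := by
  rw [← mul_pow]
  exact pow_le_pow_left' ((E p).le_opENorm (f p)) 2

lemma density_mult_le (E : Pt n → (Val n m →L[ℂ] Val n m)) (f : Pt n → Val n m) (p : Pt n) :
    density (mult E f) p ≤ density E p * ‖f p‖ₑ ^ 2 := by
  rw [density, density, ← ENNReal.mul_div_right_comm]
  gcongr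
  exact enorm_mult_sq_le E f p

end Norms

section CarlesonDahlberg

variable {n m : ℕ} {E : Pt n → (Val n m →L[ℂ] Val n m)}

lemma lintegral_whitneyEssSup_mul_le (hE : StronglyMeasurable E) {g : Pt n → ℝ≥0∞}
    (hg : Measurable g) :
    ∫⁻ q, whitneyEssSup (density E) q * g q ≤
      2 ^ n * carlesonDahlberg E ^ 2 * (6 ^ n * (unitVol n : ℝ≥0∞)⁻¹) *
        ∫⁻ x, nonTangMax g x := by
  have hS := measurable_whitneyEssSup (measurable_density hE.enorm)
  have hsupp : Function.support (fun q => whitneyEssSup (density E) q * g q) ⊆ halfSpace n := by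
    intro q hq
    by_contra hq'
    exact hq (by simp only [whitneyEssSup_of_nonpos _ (not_lt.1 hq'), zero_mul])
  rw [← setLIntegral_eq_of_support_subset hsupp, carlesonDahlberg_sq]
  calc _ = ∫⁻ q in halfSpace n, g q ∂(volume.withDensity (whitneyEssSup (density E))) := by
        rw [restrict_withDensity (measurableSet_halfSpace n),
          lintegral_withDensity_eq_lintegral_mul _ hS hg]
        rfl
    _ ≤ _ := (isCarleson_eLpNorm_carlesonFun _).lintegral_le hg

theorem normL2_mult_sq_le (hE : StronglyMeasurable E) {f : Pt n → Val n m}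
    (hf : StronglyMeasurable f) :
    normL2 (-1) (mult E f) ^ 2 ≤
      2 ^ (n + 1) * 12 ^ n * (unitVol n : ℝ≥0∞)⁻¹ ^ 2 * (carlesonDahlberg E * normN f) ^ 2 := by
  have hEm := measurable_density hE.enorm
  have hfm : Measurable fun p => ‖f p‖ₑ ^ 2 := hf.enorm.pow_const 2
  rw [normL2_neg_one_sq, mul_pow, normN_sq]
  calc ∫⁻ p, density (mult E f) p ∂(halfVol n)
      ≤ ∫⁻ p, density E p * ‖f p‖ₑ ^ 2 ∂(halfVol n) := lintegral_mono (density_mult_le E f)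
    _ ≤ 2 ^ (n + 1) * (unitVol n : ℝ≥0∞)⁻¹ *
          ∫⁻ q, whitneyAvg (fun p => density E p * ‖f p‖ₑ ^ 2) q :=
        lintegral_halfVol_le_lintegral_whitneyAvg (hEm.mul hfm)
    _ ≤ 2 ^ (n + 1) * (unitVol n : ℝ≥0∞)⁻¹ *
          ∫⁻ q, whitneyEssSup (density E) q * whitneyTwo f q ^ 2 := by
        gcongr with q
        rw [whitneyTwo_sq]
        exact whitneyAvg_mul_le _ hfm q
    _ ≤ 2 ^ (n + 1) * (unitVol n : ℝ≥0∞)⁻¹ *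
          (2 ^ n * carlesonDahlberg E ^ 2 * (6 ^ n * (unitVol n : ℝ≥0∞)⁻¹) *
            ∫⁻ x, nonTangMax (fun q => whitneyTwo f q ^ 2) x) := by
        gcongr
        exact lintegral_whitneyEssSup_mul_le hE ((measurable_whitneyTwo hf.enorm).pow_const 2)
    _ ≤ 2 ^ (n + 1) * (unitVol n : ℝ≥0∞)⁻¹ *
          (2 ^ n * carlesonDahlberg E ^ 2 * (6 ^ n * (unitVol n : ℝ≥0∞)⁻¹) *
            ∫⁻ x, nonTangMax (whitneyTwo f) x ^ 2) := by
        gcongr with x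
        exact nonTangMax_sq_le _ x
    _ = _ := by rw [show (12 : ℝ≥0∞) = 2 * 6 by norm_num, mul_pow (2 : ℝ≥0∞)]; ring

lemma whitneyTwo_mult_sq_le (E : Pt n → (Val n m →L[ℂ] Val n m)) {f : Pt n → Val n m}
    (hf : StronglyMeasurable f) (q : Pt n) :
    whitneyTwo (mult E f) q ^ 2 ≤
      whitneyEssSup (density E) q * whitneyAvg (fun p => ‖f p‖ₑ ^ 2 * ENNReal.ofReal p.1) q := by
  have hΦ : Measurable fun p => ‖f p‖ₑ ^ 2 * ENNReal.ofReal p.1 :=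
    (hf.enorm.pow_const 2).mul (by fun_prop)
  rw [whitneyTwo_sq]
  refine le_trans (whitneyAvg_mono fun p hp => ?_) (whitneyAvg_mul_le (density E) hΦ q)
  rw [mul_left_comm, density_mul E (whitney_subset_halfSpace q hp)]
  exact (enorm_mult_sq_le E f p).trans_eq (mul_comm _ _)

theorem normA_mult_sq_le (hE : StronglyMeasurable E) {f : Pt n → Val n m}
    (hf : StronglyMeasurable f) :
    normA (mult E f) ^ 2 ≤
      8 * 5 ^ n * 4 ^ (n + 1) * 12 ^ n * (unitVol n : ℝ≥0∞) ^ 2 *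
        (carlesonDahlberg E * normL2 1 f) ^ 2 := by
  set S := whitneyEssSup (density E)
  set Φ : Pt n → ℝ≥0∞ := fun p => ‖f p‖ₑ ^ 2 * ENNReal.ofReal p.1
  set w := whitneyTwo (mult E f)
  have hS : Measurable S := measurable_whitneyEssSup (measurable_density hE.enorm)
  have hΦ : Measurable Φ := (hf.enorm.pow_const 2).mul (by fun_prop)
  have hw : Measurable w := measurable_whitneyTwo (stronglyMeasurable_mult hE hf).enorm
  have hω := coe_unitVol_ne_zero n
  rw [normA_sq, mul_pow, normL2_one_sq]
  refine lintegral_sq_le_of_dual fun φ hφ => ?_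
  have hφ_avg := measurable_ballAvg hφ
  have hemb : ∫⁻ q, S q * ballAvg φ q ^ 2 ≤
      2 ^ n * carlesonDahlberg E ^ 2 * (6 ^ n * (unitVol n : ℝ≥0∞)⁻¹) *
        (8 * 5 ^ n * unitVol n ^ 2 * ∫⁻ x, φ x ^ 2) :=
    (lintegral_whitneyEssSup_mul_le hE (hφ_avg.pow_const 2)).trans <| by
      gcongr
      exact (lintegral_mono (nonTangMax_sq_le _)).trans (lintegral_sq_maximal_le hφ)
  calc (∫⁻ x, areaFun w x * φ x) ^ 2 = (∫⁻ q, w q * ballAvg φ q) ^ 2 := by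
        rw [lintegral_areaFun_mul hw hφ]
    _ ≤ (∫⁻ q, S q * ballAvg φ q ^ 2) * ∫⁻ q, whitneyAvg Φ q := by
        exact lintegral_mul_sq_le_of_sq_le hS (measurable_whitneyAvg hΦ) hφ_avg
          (whitneyTwo_mult_sq_le E hf)
    _ ≤ 2 ^ n * carlesonDahlberg E ^ 2 * (6 ^ n * (unitVol n : ℝ≥0∞)⁻¹) *
          (8 * 5 ^ n * unitVol n ^ 2 * ∫⁻ x, φ x ^ 2) *
          (4 ^ (n + 1) * unitVol n * ∫⁻ p, Φ p ∂(halfVol n)) := by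
        gcongr
        exact lintegral_whitneyAvg_le hΦ
    _ = 8 * 5 ^ n * 4 ^ (n + 1) * 12 ^ n * (unitVol n : ℝ≥0∞) ^ 2 *
          (carlesonDahlberg E ^ 2 * ∫⁻ p, Φ p ∂(halfVol n)) * (∫⁻ x, φ x ^ 2) *
          (unitVol n * (unitVol n : ℝ≥0∞)⁻¹) := by
        rw [show (12 : ℝ≥0∞) = 2 * 6 by norm_num, mul_pow (2 : ℝ≥0∞)]; ring
    _ = _ := by rw [ENNReal.mul_inv_cancel hω ENNReal.coe_ne_top, mul_one]

theorem normC_sq_le {f : Pt n → Val n m} (hf : StronglyMeasurable f) :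
    normC f ^ 2 ≤ 8 * 5 ^ n * normA f ^ 2 := by
  have hω := coe_unitVol_ne_zero n
  have hw : Measurable (whitneyTwo f) := measurable_whitneyTwo hf.enorm
  rw [normC_sq, normA_sq]
  calc ∫⁻ x, carlesonFun (whitneyTwo f) x ^ 2
      ≤ ∫⁻ x, (unitVol n : ℝ≥0∞)⁻¹ ^ 2 *
          nonTangMax (ballAvg (areaFun (whitneyTwo f))) x ^ 2 := by
        refine lintegral_mono fun x => ?_
        rw [← mul_pow]
        exact pow_le_pow_left' (carlesonFun_le_maximal hw x) 2
    _ = (unitVol n : ℝ≥0∞)⁻¹ ^ 2 *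
          ∫⁻ x, nonTangMax (ballAvg (areaFun (whitneyTwo f))) x ^ 2 :=
        lintegral_const_mul _ ((measurable_nonTangMax _).pow_const 2)
    _ ≤ (unitVol n : ℝ≥0∞)⁻¹ ^ 2 *
          (8 * 5 ^ n * unitVol n ^ 2 * ∫⁻ x, areaFun (whitneyTwo f) x ^ 2) := by
        gcongr
        exact lintegral_sq_maximal_le (measurable_areaFun hw)
    _ = 8 * 5 ^ n * (∫⁻ x, areaFun (whitneyTwo f) x ^ 2) *
          ((unitVol n : ℝ≥0∞)⁻¹ * unitVol n) ^ 2 := by ring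
    _ = _ := by rw [ENNReal.inv_mul_cancel hω ENNReal.coe_ne_top, one_pow, mul_one]

end CarlesonDahlberg

section Spread

variable {n : ℕ}

/-- The density of the measure obtained from Lebesgue measure on `T` by spreading the mass at each
`q` evenly over `U q`. -/
def spread (U : Pt n → Set (Pt n)) (T : Set (Pt n)) (p : Pt n) : ℝ≥0∞ :=
  ∫⁻ q in {q | p ∈ U q}, (volume (U q))⁻¹ ∂(volume.restrict T)

variable {U : Pt n → Set (Pt n)} {T : Set (Pt n)}

lemma measurable_inv_volume_fiber (hU : MeasurableSet {z : Pt n × Pt n | z.2 ∈ U z.1}) :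
    Measurable fun q => (volume (U q))⁻¹ :=
  (measurable_measure_prodMk_left hU).inv

lemma measurable_spread (hU : MeasurableSet {z : Pt n × Pt n | z.2 ∈ U z.1}) :
    Measurable (spread U T) :=
  measurable_lintegral_preimage_mk (measurable_swap hU)
    ((measurable_inv_volume_fiber hU).comp measurable_snd)

lemma lintegral_spread_mul (hU : MeasurableSet {z : Pt n × Pt n | z.2 ∈ U z.1})
    {Ψ : Pt n → ℝ≥0∞} (hΨ : Measurable Ψ) :
    ∫⁻ p, spread U T p * Ψ p = ∫⁻ q in T, (volume (U q))⁻¹ * ∫⁻ p in U q, Ψ p := by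
  have hV := measurable_inv_volume_fiber hU
  calc ∫⁻ p, spread U T p * Ψ p
      = ∫⁻ p, ∫⁻ q in {q | p ∈ U q}, (volume (U q))⁻¹ * Ψ p ∂(volume.restrict T) :=
        lintegral_congr fun p => (lintegral_mul_const _ hV).symm
    _ = ∫⁻ q in T, ∫⁻ p in U q, (volume (U q))⁻¹ * Ψ p :=
        (lintegral_lintegral_preimage_mk hU (f := fun z => (volume (U z.1))⁻¹ * Ψ z.2)
          ((hV.comp measurable_fst).mul (hΨ.comp measurable_snd))).symm
    _ = _ := lintegral_congr fun q => lintegral_const_mul _ hΨ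

lemma setLIntegral_spread_le (hU : MeasurableSet {z : Pt n × Pt n | z.2 ∈ U z.1})
    {s : Set (Pt n)} (hs : MeasurableSet s) :
    ∫⁻ p in s, spread U T p ≤ volume.restrict T {q | (U q ∩ s).Nonempty} := by
  have hmass (q : Pt n) : (volume (U q))⁻¹ * ∫⁻ p in U q, s.indicator 1 p ≤
      {q | (U q ∩ s).Nonempty}.indicator 1 q := by
    rw [lintegral_indicator_one hs, Measure.restrict_apply hs, inter_comm]
    by_cases hq : (U q ∩ s).Nonempty
    · rw [indicator_of_mem (by exact hq), Pi.one_apply]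
      exact (mul_le_mul_right (measure_mono inter_subset_left) _).trans (ENNReal.inv_mul_le_one _)
    · rw [not_nonempty_iff_eq_empty.1 hq, measure_empty, mul_zero]
      exact bot_le
  calc ∫⁻ p in s, spread U T p = ∫⁻ p, spread U T p * s.indicator 1 p := by
        rw [← lintegral_indicator hs]
        exact lintegral_congr fun p => by by_cases hp : p ∈ s <;> simp [hp]
    _ = ∫⁻ q in T, (volume (U q))⁻¹ * ∫⁻ p in U q, s.indicator 1 p :=
        lintegral_spread_mul hU (measurable_one.indicator hs)
    _ ≤ ∫⁻ q in T, {q | (U q ∩ s).Nonempty}.indicator 1 q := lintegral_mono hmass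
    _ ≤ _ := lintegral_indicator_one_le _

lemma exists_mem_of_spread_ne_zero (hU : MeasurableSet {z : Pt n × Pt n | z.2 ∈ U z.1})
    {p : Pt n} (hp : spread U T p ≠ 0) : ∃ q ∈ T, p ∈ U q := by
  by_contra! hT
  have hm : MeasurableSet {q | p ∈ U q} := measurable_prodMk_right hU
  have hnull : volume.restrict T {q | p ∈ U q} = 0 := by
    have hempty : {q | p ∈ U q} ∩ T = ∅ := eq_empty_of_forall_notMem fun q hq => hT q hq.2 hq.1
    rw [Measure.restrict_apply hm, hempty, measure_empty]
  exact hp (setLIntegral_measure_zero _ _ hnull)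

end Spread

section Test

variable {n : ℕ}

/-- The weights `φ`, supported in a tent, used to test a density: `φ²` has Whitney averages at
most `1`. -/
structure IsTest (φ : Pt n → ℝ≥0) (x : EuclideanSpace ℝ (Fin n)) (R : ℝ) : Prop where
  measurable : Measurable φ
  whitneyAvg_sq_le : ∀ q, whitneyAvg (fun p => (φ p : ℝ≥0∞) ^ 2) q ≤ 1
  eq_zero : ∀ p ∉ tent x R, φ p = 0

lemma volume_whitney_lt_top (q : Pt n) : volume (whitney q) < ⊤ := by
  have hsub : whitney q ⊆ Ioo (q.1 / 2) (2 * q.1) ×ˢ ball q.2 q.1 := fun p hp =>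
    have h := mem_whitney_iff.1 hp
    ⟨⟨h.1, h.2.1⟩, mem_ball_iff_norm.2 h.2.2⟩
  exact (isBounded_Ioo _ _ |>.prod isBounded_ball |>.subset hsub).measure_lt_top

lemma volume_tent_lt_top (x : EuclideanSpace ℝ (Fin n)) (r : ℝ) : volume (tent x r) < ⊤ := by
  have hsub : tent x r ⊆ Ioo 0 r ×ˢ ball x r := fun p hp =>
    ⟨⟨hp.1, by linarith [hp.2, norm_nonneg (p.2 - x)]⟩,
      mem_ball_iff_norm.2 (by linarith [hp.1, hp.2])⟩
  exact (isBounded_Ioo _ _ |>.prod isBounded_ball |>.subset hsub).measure_lt_top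

lemma mem_tent_of_mem_whitney {x : EuclideanSpace ℝ (Fin n)} {r : ℝ} {p q : Pt n}
    (hq : q ∈ tent x r) (hp : p ∈ whitney q) : p ∈ tent x (3 * r) := by
  obtain ⟨-, hp2, hpq⟩ := mem_whitney_iff.1 hp
  refine ⟨whitney_subset_halfSpace q hp, ?_⟩
  linarith [hq.2, norm_nonneg (q.2 - x), norm_sub_le_norm_sub_add_norm_sub p.2 q.2 x]

lemma whitneyAvg_spread_le {U : Pt n → Set (Pt n)} {T : Set (Pt n)}
    (hU : MeasurableSet {z : Pt n × Pt n | z.2 ∈ U z.1}) (hUW : ∀ q, U q ⊆ whitney q)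
    (z : Pt n) : whitneyAvg (spread U T) z ≤ 5 ^ (n + 1) * unitVol n := by
  rcases le_or_gt z.1 0 with hz | hz
  · rw [whitneyAvg_of_nonpos _ hz]
    exact bot_le
  · rw [whitneyAvg, mul_comm, ← div_eq_mul_inv]
    refine ENNReal.div_le_of_le_mul ?_
    calc ∫⁻ p in whitney z, spread U T p
        ≤ volume.restrict T {q | (U q ∩ whitney z).Nonempty} :=
          setLIntegral_spread_le hU (measurableSet_whitney z)
      _ ≤ volume.restrict T {q | (whitney q ∩ whitney z).Nonempty} :=
          measure_mono fun q => Nonempty.mono (inter_subset_inter_left _ (hUW q))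
      _ ≤ volume {q | (whitney q ∩ whitney z).Nonempty} := Measure.restrict_apply_le _ _
      _ ≤ _ := volume_setOf_whitney_inter_nonempty_le hz

lemma lintegral_spread_lt_top {U : Pt n → Set (Pt n)} {T : Set (Pt n)}
    (hU : MeasurableSet {z : Pt n × Pt n | z.2 ∈ U z.1}) (hT : volume T < ⊤) :
    ∫⁻ p, spread U T p < ⊤ := by
  rw [← setLIntegral_univ]
  calc _ ≤ volume.restrict T {q | (U q ∩ univ).Nonempty} :=
        setLIntegral_spread_le hU MeasurableSet.univ
    _ ≤ volume.restrict T univ := measure_mono (subset_univ _)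
    _ < ⊤ := by rwa [Measure.restrict_apply_univ]

lemma exists_isTest_ae_eq {ρ : Pt n → ℝ≥0∞} (hρ : Measurable ρ) (hρ_top : ∀ᵐ p, ρ p < ⊤)
    {C : ℝ≥0} (hC : C ≠ 0) (hρC : ∀ q, whitneyAvg ρ q ≤ C) {x : EuclideanSpace ℝ (Fin n)} {R : ℝ}
    (hρR : ∀ p ∉ tent x R, ρ p = 0) :
    ∃ φ, IsTest φ x R ∧ ∀ᵐ p, ρ p = C * (φ p : ℝ≥0∞) ^ 2 := by
  have hC0 : (C : ℝ≥0∞) ≠ 0 := ENNReal.coe_ne_zero.2 hC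
  have hsq (p : Pt n) : ((NNReal.sqrt (C⁻¹ * (ρ p).toNNReal) : ℝ≥0) : ℝ≥0∞) ^ 2 =
      (C : ℝ≥0∞)⁻¹ * (ρ p).toNNReal := by
    rw [← ENNReal.coe_pow, NNReal.sq_sqrt, ENNReal.coe_mul, ENNReal.coe_inv hC]
  refine ⟨fun p => NNReal.sqrt (C⁻¹ * (ρ p).toNNReal), ⟨by fun_prop, fun z => ?_, fun p hp => ?_⟩,
    ?_⟩
  · simp only [hsq]
    calc _ ≤ whitneyAvg (fun p => (C : ℝ≥0∞)⁻¹ * ρ p) z :=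
          whitneyAvg_mono fun p _ => mul_le_mul_right ENNReal.coe_toNNReal_le_self _
      _ = (C : ℝ≥0∞)⁻¹ * whitneyAvg ρ z := by
          simp only [whitneyAvg, lintegral_const_mul _ hρ, mul_left_comm]
      _ ≤ (C : ℝ≥0∞)⁻¹ * C := mul_le_mul_right (hρC z) _
      _ ≤ 1 := ENNReal.inv_mul_le_one _
  · simp [hρR p hp]
  · filter_upwards [hρ_top] with p hp
    rw [hsq, ENNReal.coe_toNNReal hp.ne, ← mul_assoc, ENNReal.mul_inv_cancel hC0
      ENNReal.coe_ne_top, one_mul]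

lemma le_inv_volume_mul_setLIntegral {H : Pt n → ℝ≥0∞} (hH : Measurable H) {a : ℝ≥0∞} {q : Pt n}
    (ha : a < whitneyEssSup H q) :
    a ≤ (volume (whitney q ∩ {p | a < H p}))⁻¹ * ∫⁻ p in whitney q ∩ {p | a < H p}, H p := by
  set V := whitney q ∩ {p | a < H p}
  have hV0 : volume V ≠ 0 := (lt_whitneyEssSup_iff hH).1 ha
  have hV_top : volume V ≠ ⊤ :=
    ((measure_mono inter_subset_left).trans_lt (volume_whitney_lt_top q)).ne
  calc a = (volume V)⁻¹ * ∫⁻ _ in V, a := by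
        rw [setLIntegral_const, mul_left_comm, ENNReal.inv_mul_cancel hV0 hV_top, mul_one]
    _ ≤ _ := mul_le_mul_right (setLIntegral_mono hH fun p hp => hp.2.le) _

lemma exists_isTest_le {H : Pt n → ℝ≥0∞} (hH : Measurable H) {ℓ : Pt n → ℝ≥0}
    (hℓ : Measurable ℓ) (hℓH : ∀ q, ℓ q ≠ 0 → ℓ q < whitneyEssSup H q)
    (x : EuclideanSpace ℝ (Fin n)) (r : ℝ) :
    ∃ φ, IsTest φ x (3 * r) ∧
      ∫⁻ q in tent x r, (ℓ q : ℝ≥0∞) ≤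
        5 ^ (n + 1) * unitVol n * ∫⁻ p, (φ p : ℝ≥0∞) ^ 2 * H p := by
  set U : Pt n → Set (Pt n) := fun q => whitney q ∩ {p | (ℓ q : ℝ≥0∞) < H p}
  have hU : MeasurableSet {z : Pt n × Pt n | z.2 ∈ U z.1} :=
    (measurableSet_whitneyRel n).inter (measurableSet_lt (by fun_prop) (by fun_prop))
  set ρ := spread U (tent x r)
  have hρ : Measurable ρ := measurable_spread hU
  have hρ_top : ∀ᵐ p, ρ p < ⊤ :=
    ae_lt_top hρ (lintegral_spread_lt_top hU (volume_tent_lt_top x r)).ne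
  have hsupp (p : Pt n) (hp : p ∉ tent x (3 * r)) : ρ p = 0 := by
    by_contra h
    obtain ⟨q, hq, hpq⟩ := exists_mem_of_spread_ne_zero hU h
    exact hp (mem_tent_of_mem_whitney hq hpq.1)
  obtain ⟨φ, hφ, hρφ⟩ := exists_isTest_ae_eq hρ hρ_top (C := 5 ^ (n + 1) * unitVol n)
    (mul_ne_zero (by positivity) (unitVol_ne_zero n))
    (fun q => by exact_mod_cast whitneyAvg_spread_le hU (fun _ => inter_subset_left) q) hsupp
  refine ⟨φ, hφ, ?_⟩
  calc ∫⁻ q in tent x r, (ℓ q : ℝ≥0∞)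
      ≤ ∫⁻ q in tent x r, (volume (U q))⁻¹ * ∫⁻ p in U q, H p := lintegral_mono fun q => by
        by_cases hq : ℓ q = 0
        · simp [hq]
        · exact le_inv_volume_mul_setLIntegral hH (hℓH q hq)
    _ = ∫⁻ p, ρ p * H p := (lintegral_spread_mul hU hH).symm
    _ = ∫⁻ p, 5 ^ (n + 1) * unitVol n * ((φ p : ℝ≥0∞) ^ 2 * H p) :=
        lintegral_congr_ae <| hρφ.mono fun p hp => by push_cast at hp; simp only [hp, mul_assoc]
    _ = _ := lintegral_const_mul _ (by have := hφ.measurable; fun_prop)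

lemma lintegral_tent_whitneyEssSup_le {H : Pt n → ℝ≥0∞} (hH : Measurable H)
    {x : EuclideanSpace ℝ (Fin n)} {r : ℝ} {A : ℝ≥0∞}
    (hA : ∀ φ, IsTest φ x (3 * r) → ∫⁻ p, (φ p : ℝ≥0∞) ^ 2 * H p ≤ A) :
    ∫⁻ q in tent x r, whitneyEssSup H q ≤ 2 * 5 ^ (n + 1) * unitVol n * A := by
  refine le_of_forall_lt fun L hL => ?_
  obtain ⟨g, hg, -, hLg⟩ := exists_simpleFunc_lintegral_lt hL
  have hhalf (q : Pt n) (hq : g q / 2 ≠ 0) :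
      ((g q / 2 : ℝ≥0) : ℝ≥0∞) < whitneyEssSup H q :=
    (ENNReal.coe_lt_coe.2 (NNReal.half_lt_self fun h => hq (by rw [h, zero_div]))).trans_le (hg q)
  obtain ⟨φ, hφ, hle⟩ := exists_isTest_le hH (g.measurable.div_const 2) hhalf x r
  calc L < ∫⁻ q in tent x r, (g q : ℝ≥0∞) := hLg
    _ = 2 * ∫⁻ q in tent x r, ((g q / 2 : ℝ≥0) : ℝ≥0∞) := by
        rw [← lintegral_const_mul _ (by fun_prop)]
        refine lintegral_congr fun q => ?_
        rw [ENNReal.coe_div two_ne_zero, ENNReal.coe_ofNat, ENNReal.mul_div_cancel two_ne_zero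
          ENNReal.ofNat_ne_top]
    _ ≤ 2 * (5 ^ (n + 1) * unitVol n * A) := by gcongr; exact hle.trans (by gcongr; exact hA φ hφ)
    _ = _ := by ring

end Test

section Multipliers

variable {n m : ℕ} {E : Pt n → (Val n m →L[ℂ] Val n m)}

lemma norm_le_sum_single {d : ℕ} {F : Type*} [NormedAddCommGroup F] [NormedSpace ℂ F]
    (T : EuclideanSpace ℂ (Fin d) →L[ℂ] F) : ‖T‖ ≤ ∑ j, ‖T (EuclideanSpace.single j 1)‖ := by
  refine T.opNorm_le_bound (Finset.sum_nonneg fun _ _ => norm_nonneg _) fun v => ?_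
  have hv : ∑ j, v j • EuclideanSpace.single j (1 : ℂ) = v := by
    simpa using (EuclideanSpace.basisFun (Fin d) ℂ).sum_repr v
  calc ‖T v‖ = ‖∑ j, v j • T (EuclideanSpace.single j (1 : ℂ))‖ := by
        rw [← congrArg T hv, map_sum]
        simp only [map_smul]
    _ ≤ ∑ j, ‖v j • T (EuclideanSpace.single j (1 : ℂ))‖ := norm_sum_le _ _
    _ ≤ ∑ j, ‖T (EuclideanSpace.single j 1)‖ * ‖v‖ := Finset.sum_le_sum fun j _ => by
        rw [norm_smul, mul_comm]
        exact mul_le_mul_of_nonneg_left (PiLp.norm_apply_le v j) (norm_nonneg _)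
    _ = _ := (Finset.sum_mul _ _ _).symm

lemma enorm_sq_le_sum_single {d : ℕ} {F : Type*} [NormedAddCommGroup F] [NormedSpace ℂ F]
    (T : EuclideanSpace ℂ (Fin d) →L[ℂ] F) :
    ‖T‖ₑ ^ 2 ≤ d * ∑ j, ‖T (EuclideanSpace.single j 1)‖ₑ ^ 2 := by
  have h : ‖T‖₊ ^ 2 ≤ d * ∑ j, ‖T (EuclideanSpace.single j 1)‖₊ ^ 2 := by
    rw [← NNReal.coe_le_coe]
    push_cast
    calc ‖T‖ ^ 2 ≤ (∑ j, ‖T (EuclideanSpace.single j 1)‖) ^ 2 := by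
          gcongr; exact norm_le_sum_single T
      _ ≤ _ := by
        simpa using sq_sum_le_card_mul_sum_sq (s := Finset.univ)
          (f := fun j : Fin d => ‖T (EuclideanSpace.single j 1)‖)
  simpa [enorm_eq_nnnorm] using ENNReal.coe_le_coe.2 h

lemma whitneyEssSup_density_le_sum (E : Pt n → (Val n m →L[ℂ] Val n m)) (q : Pt n) :
    whitneyEssSup (density E) q ≤ ((1 + n) * m : ℕ) *
      ∑ j, whitneyEssSup (density fun p => E p (EuclideanSpace.single j 1)) q := by
  have hsum (p : Pt n) : density E p ≤ ((1 + n) * m : ℕ) *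
      ∑ j, density (fun p => E p (EuclideanSpace.single j 1)) p := by
    simp only [density, div_eq_mul_inv]
    rw [← Finset.sum_mul, ← mul_assoc]
    exact mul_le_mul_left (enorm_sq_le_sum_single (E p)) _
  refine essSup_le_of_ae_le _ ?_
  filter_upwards [ae_all_iff.2 fun j => ENNReal.ae_le_essSup
    (density fun p => E p (EuclideanSpace.single j 1))] with p hp
  exact (hsum p).trans (mul_le_mul_right (Finset.sum_le_sum fun j _ => hp j) _)

lemma measurable_density_apply (hE : StronglyMeasurable E) (v : Val n m) :
    Measurable (density fun p => E p v) :=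
  measurable_density (stronglyMeasurable_mult hE (stronglyMeasurable_const (b := v))).enorm

/-- The tests of `E` against all test weights and unit vectors are bounded by the constant `A`. -/
def TestBound (E : Pt n → (Val n m →L[ℂ] Val n m)) (A : ℝ≥0∞) : Prop :=
  ∀ v, ‖v‖ = 1 → ∀ φ x R, 0 < R → IsTest φ x R →
    ∫⁻ p, (φ p : ℝ≥0∞) ^ 2 * density (fun p => E p v) p ≤ A * ENNReal.ofReal (R ^ n)

theorem TestBound.carlesonDahlberg_sq_le {A : ℝ≥0∞} (hA : TestBound E A)
    (hE : StronglyMeasurable E) :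
    carlesonDahlberg E ^ 2 ≤
      ((1 + n) * m : ℕ) ^ 2 * (2 * 5 ^ (n + 1) * unitVol n * 3 ^ n) * A := by
  rw [carlesonDahlberg_sq]
  refine eLpNorm_carlesonFun_le (isCarleson_withDensity_iff.2 fun x r hr => ?_)
  calc ∫⁻ p in tent x r, whitneyEssSup (density E) p
      ≤ ∫⁻ p in tent x r, ((1 + n) * m : ℕ) *
          ∑ j, whitneyEssSup (density fun p => E p (EuclideanSpace.single j 1)) p :=
        lintegral_mono (whitneyEssSup_density_le_sum E)
    _ = ((1 + n) * m : ℕ) * ∑ j, ∫⁻ p in tent x r,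
          whitneyEssSup (density fun p => E p (EuclideanSpace.single j 1)) p := by
        have hS (j) := measurable_whitneyEssSup
          (measurable_density_apply hE (EuclideanSpace.single j 1))
        rw [lintegral_const_mul _ (Finset.measurable_fun_sum _ fun j _ => hS j),
          lintegral_finsetSum _ fun j _ => hS j]
    _ ≤ ((1 + n) * m : ℕ) * ∑ _j : Fin ((1 + n) * m),
          2 * 5 ^ (n + 1) * unitVol n * (A * (3 ^ n * ENNReal.ofReal (r ^ n))) := by
        gcongr with j
        refine lintegral_tent_whitneyEssSup_le (measurable_density_apply hE _) fun φ hφ => ?_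
        rw [← ENNReal.ofReal_ofNat 3, ← ofReal_mul_pow (by norm_num)]
        exact hA _ (by simp) φ x _ (by positivity) hφ
    _ = _ := by
        rw [Finset.sum_const, Finset.card_univ, Fintype.card_fin, nsmul_eq_mul]
        ring

end Multipliers

section TestFunctions

variable {n m : ℕ} {E : Pt n → (Val n m →L[ℂ] Val n m)} {φ : Pt n → ℝ≥0}
  {x : EuclideanSpace ℝ (Fin n)} {R : ℝ}

lemma mult_smul (E : Pt n → (Val n m →L[ℂ] Val n m)) (φ : Pt n → ℝ≥0) (f : Pt n → Val n m) :
    mult E (fun p => φ p • f p) = fun p => φ p • mult E f p :=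
  funext fun p => (E p).map_smul_of_tower (φ p) (f p)

lemma enorm_nnreal_smul {F : Type*} [NormedAddCommGroup F] [NormedSpace ℝ F] (c : ℝ≥0) (v : F) :
    ‖c • v‖ₑ = c * ‖v‖ₑ := by
  rw [NNReal.smul_def, enorm_smul, Real.enorm_of_nonneg c.coe_nonneg, ENNReal.ofReal_coe_nnreal]

lemma enorm_smul_unit {v : Val n m} (hv : ‖v‖ = 1) (c : ℝ≥0) : ‖c • v‖ₑ = c := by
  rw [enorm_nnreal_smul, ← ofReal_norm, hv, ENNReal.ofReal_one, mul_one]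

lemma density_mult_smul (E : Pt n → (Val n m →L[ℂ] Val n m)) (φ : Pt n → ℝ≥0) (v : Val n m)
    (p : Pt n) : density (mult E fun p => φ p • v) p =
      (φ p : ℝ≥0∞) ^ 2 * density (fun p => E p v) p := by
  rw [density, mult_smul, enorm_nnreal_smul, mul_pow, mul_div_assoc]
  rfl

lemma mem_tent_of_whitney_inter_tent {p q : Pt n} (hpq : p ∈ whitney q) (hp : p ∈ tent x R) :
    q ∈ tent x (4 * R) := by
  obtain ⟨h₁, h₂, h₃⟩ := mem_whitney_iff.1 hpq
  rw [norm_sub_rev] at h₃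
  refine ⟨by linarith [hp.1], ?_⟩
  linarith [hp.1, hp.2, norm_nonneg (p.2 - x), norm_sub_le_norm_sub_add_norm_sub q.2 p.2 x]

lemma IsTest.whitneyAvg_eq_zero (hφ : IsTest φ x R) (g : Pt n → ℝ≥0∞) {q : Pt n}
    (hq : q ∉ tent x (4 * R)) : whitneyAvg (fun p => (φ p : ℝ≥0∞) ^ 2 * g p) q = 0 :=
  CarlesonMult.whitneyAvg_eq_zero fun p hp => by
    rw [hφ.eq_zero p fun hpR => hq (mem_tent_of_whitney_inter_tent hp hpR)]
    simp

lemma IsTest.nonTangMax_whitneyTwo_le (hφ : IsTest φ x R) {v : Val n m} (hv : ‖v‖ = 1)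
    (z : EuclideanSpace ℝ (Fin n)) :
    nonTangMax (whitneyTwo fun p => φ p • v) z ≤ (ball x (4 * R)).indicator 1 z := by
  refine iSup₂_le fun q hq => (ENNReal.pow_le_pow_left_iff two_ne_zero).1 ?_
  simp only [whitneyTwo_sq, enorm_smul_unit hv]
  by_cases hqR : q ∈ tent x (4 * R)
  · have hz : z ∈ ball x (4 * R) := by
      rw [mem_ball_iff_norm]
      rw [norm_sub_rev] at hq
      linarith [hqR.2, norm_sub_le_norm_sub_add_norm_sub z q.2 x]
    rw [indicator_of_mem hz, Pi.one_apply, one_pow]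
    exact hφ.whitneyAvg_sq_le q
  · simpa only [Pi.one_apply, mul_one] using (hφ.whitneyAvg_eq_zero 1 hqR).trans_le bot_le

lemma IsTest.normN_sq_le (hφ : IsTest φ x R) (hR : 0 < R) {v : Val n m} (hv : ‖v‖ = 1) :
    normN (fun p => φ p • v) ^ 2 ≤ unitVol n * 4 ^ n * ENNReal.ofReal (R ^ n) := by
  rw [normN_sq]
  calc _ ≤ ∫⁻ z, (ball x (4 * R)).indicator 1 z := lintegral_mono fun z =>
        (pow_le_pow_left' (hφ.nonTangMax_whitneyTwo_le hv z) 2).trans_eq <| by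
          by_cases hz : z ∈ ball x (4 * R) <;> simp [hz]
    _ = _ := by
        rw [lintegral_indicator_one measurableSet_ball, volume_ball_eq x (by positivity),
          ofReal_mul_pow (by norm_num), ENNReal.ofReal_ofNat, mul_assoc]

lemma IsTest.stronglyMeasurable_smul (hφ : IsTest φ x R) (v : Val n m) :
    StronglyMeasurable fun p => φ p • v :=
  hφ.measurable.stronglyMeasurable.smul_const v

lemma IsTest.lintegral_halfVol (hφ : IsTest φ x R) (g : Pt n → ℝ≥0∞) :
    ∫⁻ p, (φ p : ℝ≥0∞) ^ 2 * g p ∂(halfVol n) = ∫⁻ p, (φ p : ℝ≥0∞) ^ 2 * g p := by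
  refine setLIntegral_eq_of_support_subset fun p hp => ?_
  by_contra hp'
  exact hp (by simp [hφ.eq_zero p fun hpR => hp' hpR.1])

lemma testBound_of_normL2 {B : ℝ≥0∞}
    (hB : ∀ f, StronglyMeasurable f → normN f < ⊤ → normL2 (-1) (mult E f) ≤ B * normN f) :
    TestBound E (unitVol n * 4 ^ n * B ^ 2) := fun v hv φ x R hR hφ => by
  have hN := hφ.normN_sq_le hR hv
  have hN_top : normN (fun p => φ p • v) < ⊤ :=
    (ENNReal.pow_lt_top_iff.1 (hN.trans_lt (by finiteness))).resolve_right two_ne_zero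
  calc ∫⁻ p, (φ p : ℝ≥0∞) ^ 2 * density (fun p => E p v) p
      = normL2 (-1) (mult E fun p => φ p • v) ^ 2 := by
        rw [normL2_neg_one_sq, ← hφ.lintegral_halfVol]
        simp only [density_mult_smul]
    _ ≤ (B * normN fun p => φ p • v) ^ 2 :=
        pow_le_pow_left' (hB _ (hφ.stronglyMeasurable_smul v) hN_top) 2
    _ ≤ B ^ 2 * (unitVol n * 4 ^ n * ENNReal.ofReal (R ^ n)) := by
        rw [mul_pow]
        exact mul_le_mul_right hN _
    _ = _ := by ring

lemma lintegral_tent_sq_le (g : Pt n → ℝ≥0∞) (x : EuclideanSpace ℝ (Fin n)) {R : ℝ} (hR : 0 < R) :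
    (∫⁻ p in tent x (4 * R), g p) ^ 2 ≤
      25 ^ n * (unitVol n : ℝ≥0∞)⁻¹ * ENNReal.ofReal (R ^ n) * ∫⁻ z, carlesonFun g z ^ 2 := by
  have hz : ∀ z ∈ ball x R,
      (∫⁻ p in tent x (4 * R), g p) ^ 2 ≤ (carlesonFun g z * ENNReal.ofReal ((5 * R) ^ n)) ^ 2 :=
    fun z hz => by
      have hsub : tent x (4 * R) ⊆ tent z (5 * R) := tent_subset_tent (by
        rw [mem_ball_iff_norm, norm_sub_rev] at hz
        linarith)
      exact pow_le_pow_left' ((lintegral_mono_set hsub).trans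
        (lintegral_tent_le_carlesonFun g z (by positivity))) 2
  have hball : (∫⁻ p in tent x (4 * R), g p) ^ 2 * (unitVol n * ENNReal.ofReal (R ^ n)) ≤
      (∫⁻ z, carlesonFun g z ^ 2) * ENNReal.ofReal ((5 * R) ^ n) ^ 2 := by
    calc _ = ∫⁻ _ in ball x R, (∫⁻ p in tent x (4 * R), g p) ^ 2 := by
          rw [setLIntegral_const, volume_ball_eq x hR]
      _ ≤ ∫⁻ z in ball x R, (carlesonFun g z * ENNReal.ofReal ((5 * R) ^ n)) ^ 2 :=
          setLIntegral_mono' measurableSet_ball hz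
      _ ≤ ∫⁻ z, (carlesonFun g z * ENNReal.ofReal ((5 * R) ^ n)) ^ 2 :=
          setLIntegral_le_lintegral _ _
      _ = _ := by
          simp only [mul_pow]
          exact lintegral_mul_const' _ _ (by finiteness)
  have hω := coe_unitVol_ne_zero n
  refine (ENNReal.mul_le_mul_iff_left (mul_ne_zero hω (ofReal_pow_ne_zero hR n))
    (by finiteness)).1 (hball.trans_eq ?_)
  calc _ = 25 ^ n * ENNReal.ofReal (R ^ n) * (∫⁻ z, carlesonFun g z ^ 2) *
        ENNReal.ofReal (R ^ n) * 1 := by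
        rw [ofReal_mul_pow (by norm_num), ENNReal.ofReal_ofNat,
          show (25 : ℝ≥0∞) = 5 * 5 by norm_num, mul_pow (5 : ℝ≥0∞)]
        ring
    _ = _ := by rw [← ENNReal.inv_mul_cancel hω ENNReal.coe_ne_top]; ring

end TestFunctions

section RootWeight

variable {n m : ℕ} {E : Pt n → (Val n m →L[ℂ] Val n m)} {φ g : Pt n → ℝ≥0}
  {x : EuclideanSpace ℝ (Fin n)} {R : ℝ}

/-- The weight `φ√(g/t)`. For `g` below the density of `u = E v`, multiplying it by `v` gives the
functions on which the boundedness of `E` from `L₂(t)` is tested. -/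
def rootWeight (φ g : Pt n → ℝ≥0) (p : Pt n) : ℝ≥0 :=
  φ p * NNReal.sqrt (g p / p.1.toNNReal)

lemma measurable_rootWeight (hφ : Measurable φ) (hg : Measurable g) :
    Measurable (rootWeight φ g) := by
  unfold rootWeight
  fun_prop

lemma rootWeight_sq (φ g : Pt n → ℝ≥0) {p : Pt n} (hp : p ∈ halfSpace n) :
    (rootWeight φ g p : ℝ≥0∞) ^ 2 = (φ p : ℝ≥0∞) ^ 2 * (g p / ENNReal.ofReal p.1) := by
  rw [rootWeight, ENNReal.coe_mul, mul_pow, ← ENNReal.coe_pow (NNReal.sqrt _), NNReal.sq_sqrt,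
    ENNReal.coe_div (Real.toNNReal_pos.2 hp).ne']
  rfl

lemma rootWeight_sq_mul (φ g : Pt n → ℝ≥0) {p : Pt n} (hp : p ∈ halfSpace n) :
    (rootWeight φ g p : ℝ≥0∞) ^ 2 * ENNReal.ofReal p.1 = (φ p : ℝ≥0∞) ^ 2 * g p := by
  rw [rootWeight_sq φ g hp, mul_assoc,
    ENNReal.div_mul_cancel (ENNReal.ofReal_pos.2 hp).ne' ENNReal.ofReal_ne_top]

lemma sq_le_enorm_rootWeight_smul {u : Pt n → Val n m} (hgu : ∀ p, g p ≤ density u p) {p : Pt n}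
    (hp : p ∈ halfSpace n) : (φ p * g p : ℝ≥0∞) ^ 2 ≤ ‖rootWeight φ g p • u p‖ₑ ^ 2 := by
  rw [enorm_nnreal_smul, mul_pow _ ‖u p‖ₑ, ← density_mul u hp, mul_left_comm,
    rootWeight_sq_mul φ g hp, mul_pow, sq (g p : ℝ≥0∞), ← mul_assoc, mul_comm (density u p)]
  exact mul_le_mul_right (hgu p) _

lemma IsTest.whitneyAvg_mul_le (hφ : IsTest φ x R) (hg : Measurable g) {u : Pt n → Val n m}
    (hgu : ∀ p, g p ≤ density u p) (q : Pt n) :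
    whitneyAvg (fun p => (φ p : ℝ≥0∞) ^ 2 * g p) q ≤
      whitneyTwo (fun p => rootWeight φ g p • u p) q := by
  have hφm := hφ.measurable
  rw [← ENNReal.pow_le_pow_left_iff two_ne_zero, whitneyTwo_sq]
  calc whitneyAvg (fun p => (φ p : ℝ≥0∞) ^ 2 * g p) q ^ 2
      = whitneyAvg (fun p => (φ p : ℝ≥0∞) * (φ p * g p)) q ^ 2 := by simp only [sq, mul_assoc]
    _ ≤ whitneyAvg (fun p => (φ p : ℝ≥0∞) ^ 2) q * whitneyAvg (fun p => (φ p * g p) ^ 2) q :=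
        whitneyAvg_mul_sq_le (by fun_prop) (by fun_prop) q
    _ ≤ 1 * whitneyAvg (fun p => ‖rootWeight φ g p • u p‖ₑ ^ 2) q :=
        mul_le_mul' (hφ.whitneyAvg_sq_le q) <| whitneyAvg_mono fun p hp =>
          sq_le_enorm_rootWeight_smul hgu (whitney_subset_halfSpace q hp)
    _ = _ := one_mul _

lemma IsTest.lintegral_mul_le_lintegral_tent (hφ : IsTest φ x R) (hg : Measurable g)
    {u : Pt n → Val n m} (hgu : ∀ p, g p ≤ density u p) :
    ∫⁻ p, (φ p : ℝ≥0∞) ^ 2 * g p ≤ 2 ^ (n + 1) * (unitVol n : ℝ≥0∞)⁻¹ *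
      ∫⁻ q in tent x (4 * R), whitneyTwo (fun p => rootWeight φ g p • u p) q := by
  have hφm := hφ.measurable
  have hsupp : Function.support (whitneyAvg fun p => (φ p : ℝ≥0∞) ^ 2 * g p) ⊆ tent x (4 * R) :=
    fun q hq => by_contra fun hqR => hq (hφ.whitneyAvg_eq_zero _ hqR)
  rw [← hφ.lintegral_halfVol]
  calc _ ≤ 2 ^ (n + 1) * (unitVol n : ℝ≥0∞)⁻¹ *
        ∫⁻ q, whitneyAvg (fun p => (φ p : ℝ≥0∞) ^ 2 * g p) q :=
        lintegral_halfVol_le_lintegral_whitneyAvg (by fun_prop)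
    _ ≤ _ := by
        rw [← setLIntegral_eq_of_support_subset hsupp]
        exact mul_le_mul_right (lintegral_mono (hφ.whitneyAvg_mul_le hg hgu)) _

lemma IsTest.normL2_rootWeight_sq (hφ : IsTest φ x R) (g : Pt n → ℝ≥0) {v : Val n m}
    (hv : ‖v‖ = 1) :
    normL2 1 (fun p => rootWeight φ g p • v) ^ 2 = ∫⁻ p, (φ p : ℝ≥0∞) ^ 2 * g p := by
  rw [normL2_one_sq, ← hφ.lintegral_halfVol]
  refine setLIntegral_congr_fun (measurableSet_halfSpace n) fun p hp => ?_
  simp only [enorm_smul_unit hv, rootWeight_sq_mul φ g hp]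

lemma le_of_sq_le_mul_self {a c : ℝ≥0∞} (ha : a ≠ ⊤) (h : a ^ 2 ≤ c * a) : a ≤ c := by
  rcases eq_or_ne a 0 with rfl | ha₀
  · exact bot_le
  · exact (ENNReal.mul_le_mul_iff_left ha₀ ha).1 (by rwa [← sq])

lemma IsTest.lintegral_mul_le_of_normC (hφ : IsTest φ x R) (hR : 0 < R) {B : ℝ≥0∞}
    (hB : ∀ f, StronglyMeasurable f → normL2 1 f < ⊤ → normC (mult E f) ≤ B * normL2 1 f)
    (hg : Measurable g) (hg_top : ∫⁻ p, (φ p : ℝ≥0∞) ^ 2 * g p < ⊤) {v : Val n m} (hv : ‖v‖ = 1)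
    (hgE : ∀ p, g p ≤ density (fun p => E p v) p) :
    ∫⁻ p, (φ p : ℝ≥0∞) ^ 2 * g p ≤
      4 ^ (n + 1) * 25 ^ n * (unitVol n : ℝ≥0∞)⁻¹ ^ 3 * B ^ 2 * ENNReal.ofReal (R ^ n) := by
  set X := ∫⁻ p, (φ p : ℝ≥0∞) ^ 2 * g p
  set f : Pt n → Val n m := fun p => rootWeight φ g p • v
  have hf : StronglyMeasurable f :=
    (measurable_rootWeight hφ.measurable hg).stronglyMeasurable.smul_const v
  have hfX : normL2 1 f ^ 2 = X := hφ.normL2_rootWeight_sq g hv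
  have hX : X ≤ 2 ^ (n + 1) * (unitVol n : ℝ≥0∞)⁻¹ *
      ∫⁻ q in tent x (4 * R), whitneyTwo (mult E f) q := by
    rw [mult_smul]
    exact hφ.lintegral_mul_le_lintegral_tent hg hgE
  have hBX : normC (mult E f) ^ 2 ≤ B ^ 2 * X := by
    rw [← hfX, ← mul_pow]
    exact pow_le_pow_left' (hB f hf ((ENNReal.pow_lt_top_iff.1
      (hfX.trans_lt hg_top)).resolve_right two_ne_zero)) 2
  refine le_of_sq_le_mul_self hg_top.ne ?_
  calc X ^ 2 ≤ (2 ^ (n + 1) * (unitVol n : ℝ≥0∞)⁻¹ *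
        ∫⁻ q in tent x (4 * R), whitneyTwo (mult E f) q) ^ 2 := pow_le_pow_left' hX 2
    _ = 4 ^ (n + 1) * (unitVol n : ℝ≥0∞)⁻¹ ^ 2 *
          (∫⁻ q in tent x (4 * R), whitneyTwo (mult E f) q) ^ 2 := by
        rw [show (4 : ℝ≥0∞) = 2 * 2 by norm_num, mul_pow (2 : ℝ≥0∞)]; ring
    _ ≤ 4 ^ (n + 1) * (unitVol n : ℝ≥0∞)⁻¹ ^ 2 *
          (25 ^ n * (unitVol n : ℝ≥0∞)⁻¹ * ENNReal.ofReal (R ^ n) * (B ^ 2 * X)) := by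
        gcongr
        exact (lintegral_tent_sq_le _ x hR).trans (mul_le_mul_right (normC_sq _ ▸ hBX) _)
    _ = _ := by ring

lemma testBound_of_normC {B : ℝ≥0∞} (hE : StronglyMeasurable E)
    (hB : ∀ f, StronglyMeasurable f → normL2 1 f < ⊤ → normC (mult E f) ≤ B * normL2 1 f) :
    TestBound E (4 ^ (n + 1) * 25 ^ n * (unitVol n : ℝ≥0∞)⁻¹ ^ 3 * B ^ 2) :=
  fun v hv φ x R hR hφ => by
  have hφm : Measurable fun p => (φ p : ℝ≥0∞) ^ 2 := hφ.measurable.coe_nnreal_ennreal.pow_const 2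
  have hμ (g : Pt n → ℝ≥0∞) (hg : Measurable g) : ∫⁻ p, (φ p : ℝ≥0∞) ^ 2 * g p =
      ∫⁻ p, g p ∂(volume.withDensity fun p => (φ p : ℝ≥0∞) ^ 2) := by
    rw [lintegral_withDensity_eq_lintegral_mul _ hφm hg]
    rfl
  have hfin : SigmaFinite (volume.withDensity fun p => (φ p : ℝ≥0∞) ^ 2) :=
    SigmaFinite.withDensity_of_ne_top (.of_forall fun p => by finiteness)
  rw [hμ _ (measurable_density_apply hE v)]
  refine le_of_forall_lt fun L hL => ?_
  obtain ⟨g, hgE, hg_top, hLg⟩ := exists_simpleFunc_lintegral_lt hL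
  rw [← hμ _ (by fun_prop)] at hg_top hLg
  exact hLg.trans_le (hφ.lintegral_mul_le_of_normC hR hB g.measurable hg_top hv hgE)

end RootWeight

section Gauges

variable {n m : ℕ} {ν ν' : (Pt n → Val n m) → ℝ≥0∞} {E E' : Pt n → (Val n m →L[ℂ] Val n m)}

/-- The properties of the functionals `normN`, `normC`, `normA`, `normL2 α` by which norm
inequalities for multiplication operators can be reduced to measurable representatives and to
functions of norm one: dependence on the almost everywhere class only, and homogeneity. -/
structure IsGauge (ν : (Pt n → Val n m) → ℝ≥0∞) : Prop where
  congr : ∀ {f g}, f =ᵐ[halfVol n] g → ν f = ν g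
  smul : ∀ (c : ℝ≥0) f, ν (fun p => c • f p) = c * ν f

/-- A gauge that vanishes only on null functions. -/
structure IsDefiniteGauge (ν : (Pt n → Val n m) → ℝ≥0∞) : Prop extends IsGauge ν where
  ae_eq_zero : ∀ {f}, AEStronglyMeasurable f (halfVol n) → ν f = 0 → f =ᵐ[halfVol n] 0

lemma IsGauge.eq_zero (hν : IsGauge ν) {f : Pt n → Val n m} (hf : f =ᵐ[halfVol n] 0) :
    ν f = 0 := by
  have h : f =ᵐ[halfVol n] fun p => (0 : ℝ≥0) • f p :=
    hf.mono fun p hp => hp.trans (zero_smul _ _).symm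
  rw [hν.congr h, hν.smul, ENNReal.coe_zero, zero_mul]

lemma mult_congr {f f' : Pt n → Val n m} (hE : E =ᵐ[halfVol n] E') (hf : f =ᵐ[halfVol n] f') :
    mult E f =ᵐ[halfVol n] mult E' f' := by
  filter_upwards [hE, hf] with p hEp hfp
  rw [mult, mult, hEp, hfp]

lemma aestronglyMeasurable_mult (hE : AEStronglyMeasurable E (halfVol n)) {f : Pt n → Val n m}
    (hf : AEStronglyMeasurable f (halfVol n)) : AEStronglyMeasurable (mult E f) (halfVol n) :=
  ⟨_, stronglyMeasurable_mult hE.stronglyMeasurable_mk hf.stronglyMeasurable_mk,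
    mult_congr hE.ae_eq_mk hf.ae_eq_mk⟩

lemma opNorm_congr (hν' : IsGauge ν') (h : E =ᵐ[halfVol n] E') :
    opNorm ν ν' E = opNorm ν ν' E' := by
  simp only [opNorm, fun f => hν'.congr (mult_congr h (EventuallyEq.refl _ f))]

lemma opNorm_le (hν : IsGauge ν) (hν' : IsGauge ν') {B : ℝ≥0∞}
    (h : ∀ f, StronglyMeasurable f → ν f = 1 → ν' (mult E f) ≤ B) : opNorm ν ν' E ≤ B := by
  refine iSup₂_le fun f hf => ?_
  have hfg := hf.1.1.ae_eq_mk
  rw [hν'.congr (mult_congr (EventuallyEq.refl _ E) hfg)]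
  exact h _ hf.1.1.stronglyMeasurable_mk ((hν.congr hfg).symm.trans hf.2)

lemma le_opNorm {f : Pt n → Val n m} (hf : AEStronglyMeasurable f (halfVol n)) (hf1 : ν f = 1) :
    ν' (mult E f) ≤ opNorm ν ν' E :=
  le_iSup₂ (f := fun (f : Pt n → Val n m) (_ : MemSpace ν f ∧ ν f = 1) => ν' (mult E f)) f
    ⟨⟨hf, hf1 ▸ ENNReal.one_lt_top⟩, hf1⟩

lemma le_opNorm_mul (hν : IsDefiniteGauge ν) (hν' : IsGauge ν') {f : Pt n → Val n m}
    (hf : MemSpace ν f) : ν' (mult E f) ≤ opNorm ν ν' E * ν f := by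
  rcases eq_or_ne (ν f) 0 with hzero | hzero
  · have hmult : mult E f =ᵐ[halfVol n] 0 :=
      (hν.ae_eq_zero hf.1 hzero).mono fun p hp => by rw [mult, hp, Pi.zero_apply, map_zero]
    rw [hν'.eq_zero hmult]
    exact zero_le
  · set c : ℝ≥0 := (ν f).toNNReal⁻¹
    have hc : (c : ℝ≥0∞) = (ν f)⁻¹ := by
      rw [ENNReal.coe_inv (ENNReal.toNNReal_ne_zero.2 ⟨hzero, hf.2.ne⟩),
        ENNReal.coe_toNNReal hf.2.ne]
    have hunit : ν (fun p => c • f p) = 1 := by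
      rw [hν.smul, hc, ENNReal.inv_mul_cancel hzero hf.2.ne]
    have hle := le_opNorm (ν' := ν') (E := E) (f := fun p => c • f p) (hf.1.const_smul c) hunit
    rwa [mult_smul, hν'.smul, hc, mul_comm, ← div_eq_mul_inv,
      ENNReal.div_le_iff hzero hf.2.ne] at hle

lemma isBoundedMult_iff (hν : IsDefiniteGauge ν) (hν' : IsGauge ν')
    (hE : AEStronglyMeasurable E (halfVol n)) : IsBoundedMult ν ν' E ↔ opNorm ν ν' E < ∞ := by
  constructor
  · rintro ⟨K, hK⟩
    exact (iSup₂_le fun f hf => by simpa only [hf.2, mul_one] using (hK f hf.1).2).trans_lt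
      ENNReal.coe_lt_top
  · intro h
    refine ⟨(opNorm ν ν' E).toNNReal, fun f hf => ?_⟩
    have hle := le_opNorm_mul (E := E) hν hν' hf
    rw [ENNReal.coe_toNNReal h.ne]
    exact ⟨⟨aestronglyMeasurable_mult hE hf.1, hle.trans_lt (ENNReal.mul_lt_top h hf.2)⟩, hle⟩

end Gauges

section NormGauges

variable {n m : ℕ}

lemma whitneyTwo_congr {F : Type*} [NormedAddCommGroup F] {f g : Pt n → F}
    (h : f =ᵐ[halfVol n] g) : whitneyTwo f = whitneyTwo g := by
  funext q
  rw [whitneyTwo, whitneyTwo, eLpNorm_congr_ae (ae_mono (restrict_whitney_le q) h)]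

lemma whitneySup_congr {F : Type*} [NormedAddCommGroup F] {f g : Pt n → F}
    (h : f =ᵐ[halfVol n] g) : whitneySup f = whitneySup g := by
  funext q
  rw [whitneySup, whitneySup, eLpNorm_congr_ae (ae_mono (restrict_whitney_le q) h)]

lemma carlesonDahlberg_congr {E E' : Pt n → (Val n m →L[ℂ] Val n m)}
    (h : E =ᵐ[halfVol n] E') : carlesonDahlberg E = carlesonDahlberg E' := by
  rw [carlesonDahlberg, carlesonDahlberg,
    whitneySup_congr (h.mono fun p hp => congrArg (fun T => ‖T‖ ^ 2 / p.1) hp)]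

lemma whitneyTwo_smul (c : ℝ≥0) (f : Pt n → Val n m) :
    whitneyTwo (fun p => c • f p) = fun q => c * whitneyTwo f q := by
  funext q
  refine (ENNReal.pow_right_strictMono two_ne_zero).injective ?_
  beta_reduce
  simp_rw [mul_pow, whitneyTwo_sq, whitneyAvg, enorm_nnreal_smul, mul_pow]
  rw [lintegral_const_mul' _ _ (ENNReal.pow_ne_top ENNReal.coe_ne_top), mul_left_comm]

lemma eLpNorm_two_const_mul {α : Type*} [MeasurableSpace α] {μ : Measure α} (c : ℝ≥0)
    (g : α → ℝ≥0∞) : eLpNorm (fun x => c * g x) 2 μ = c * eLpNorm g 2 μ := by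
  refine (ENNReal.pow_right_strictMono two_ne_zero).injective ?_
  simp_rw [mul_pow, eLpNorm_two_sq, enorm_eq_self, mul_pow]
  exact lintegral_const_mul' _ _ (ENNReal.pow_ne_top ENNReal.coe_ne_top)

lemma ae_eq_zero_of_normN_eq_zero {f : Pt n → Val n m} (hf : StronglyMeasurable f)
    (h : normN f = 0) : f =ᵐ[halfVol n] 0 := by
  have hN : (fun x => nonTangMax (whitneyTwo f) x ^ 2) =ᵐ[volume] 0 := by
    rw [← lintegral_eq_zero_iff ((measurable_nonTangMax _).pow_const 2), ← normN_sq, h,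
      zero_pow two_ne_zero]
  have hW (q : Pt n) : whitneyTwo f q ^ 2 = 0 := by
    rcases le_or_gt q.1 0 with hq | hq
    · rw [whitneyTwo_sq, whitneyAvg_of_nonpos _ hq]
    by_contra hne
    refine (measure_ball_pos volume q.2 hq).ne' (measure_mono_null
      (fun x hx (hx0 : nonTangMax (whitneyTwo f) x ^ 2 = 0) => hne ?_) (ae_iff.1 hN))
    rw [mem_ball', dist_eq_norm] at hx
    exact le_bot_iff.1 ((pow_le_pow_left' (le_nonTangMax _ hx) 2).trans_eq hx0)
  have hint : ∫⁻ p, ‖f p‖ₑ ^ 2 ∂(halfVol n) = 0 := by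
    refine le_bot_iff.1
      ((lintegral_halfVol_le_lintegral_whitneyAvg (hf.enorm.pow_const 2)).trans_eq ?_)
    simp only [← whitneyTwo_sq, hW, lintegral_zero, mul_zero, bot_eq_zero]
  rw [lintegral_eq_zero_iff (hf.enorm.pow_const 2)] at hint
  exact hint.mono fun p hp => enorm_eq_zero.1 (pow_eq_zero_iff two_ne_zero |>.1 hp)

lemma ae_eq_zero_of_normL2_eq_zero {α : ℝ} {f : Pt n → Val n m} (hf : StronglyMeasurable f)
    (h : normL2 α f = 0) : f =ᵐ[halfVol n] 0 := by
  rw [normL2, ENNReal.rpow_eq_zero_iff_of_pos one_half_pos,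
    lintegral_eq_zero_iff (by fun_prop (disch := exact hf.enorm))] at h
  filter_upwards [h, ae_restrict_mem (measurableSet_halfSpace n)] with p hp hp0
  have hweight : ENNReal.ofReal (p.1 ^ α) ≠ 0 :=
    (ENNReal.ofReal_pos.2 (Real.rpow_pos_of_pos hp0 α)).ne'
  exact enorm_eq_zero.1 (pow_eq_zero_iff two_ne_zero |>.1 ((mul_eq_zero_iff_right hweight).1 hp))

lemma IsGauge.isDefiniteGauge {ν : (Pt n → Val n m) → ℝ≥0∞} (hν : IsGauge ν)
    (h : ∀ {f}, StronglyMeasurable f → ν f = 0 → f =ᵐ[halfVol n] 0) : IsDefiniteGauge ν where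
  toIsGauge := hν
  ae_eq_zero hf hf0 := hf.ae_eq_mk.trans
    (h hf.stronglyMeasurable_mk ((hν.congr hf.ae_eq_mk).symm.trans hf0))

lemma isGauge_eLpNorm_two_whitneyTwo {S : (Pt n → ℝ≥0∞) → EuclideanSpace ℝ (Fin n) → ℝ≥0∞}
    (hS : ∀ (c : ℝ≥0) g x, S (fun q => c * g q) x = c * S g x) :
    IsGauge fun f : Pt n → Val n m => eLpNorm (S (whitneyTwo f)) 2 volume where
  congr h := by rw [whitneyTwo_congr h]
  smul c f := by
    rw [whitneyTwo_smul, ← eLpNorm_two_const_mul]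
    exact congrArg (eLpNorm · 2 volume) (funext (hS c _))

lemma isDefiniteGauge_normN : IsDefiniteGauge (normN (n := n) (m := m)) :=
  (isGauge_eLpNorm_two_whitneyTwo fun c g x => by
    simp_rw [nonTangMax, ENNReal.mul_iSup]).isDefiniteGauge ae_eq_zero_of_normN_eq_zero

lemma isGauge_normC : IsGauge (normC (n := n) (m := m)) :=
  isGauge_eLpNorm_two_whitneyTwo fun c g x => by
    simp_rw [carlesonFun, ENNReal.mul_iSup, lintegral_const_mul' _ _ ENNReal.coe_ne_top,
      mul_left_comm]

lemma isGauge_normA : IsGauge (normA (n := n) (m := m)) :=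
  isGauge_eLpNorm_two_whitneyTwo fun c g x => by
    simp_rw [areaFun, mul_assoc, lintegral_const_mul' _ _ ENNReal.coe_ne_top]

lemma isGauge_normL2 (α : ℝ) : IsGauge (normL2 (n := n) (m := m) α) where
  congr h := congrArg (· ^ (1 / 2 : ℝ)) <| lintegral_congr_ae <|
    h.mono fun p hp => by beta_reduce; rw [hp]
  smul c f := by
    refine (ENNReal.pow_right_strictMono two_ne_zero).injective ?_
    beta_reduce
    simp_rw [mul_pow, normL2, rpow_half_sq, enorm_nnreal_smul, mul_pow, mul_assoc]
    exact lintegral_const_mul' _ _ (ENNReal.pow_ne_top ENNReal.coe_ne_top)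

lemma isDefiniteGauge_normL2 (α : ℝ) : IsDefiniteGauge (normL2 (n := n) (m := m) α) :=
  (isGauge_normL2 α).isDefiniteGauge ae_eq_zero_of_normL2_eq_zero

end NormGauges

section Comparison

lemma exists_forall_le_mul_of_sq_le {c : ℝ≥0∞} (hc : c ≠ ∞) :
    ∃ K : ℝ≥0, ∀ a b : ℝ≥0∞, a ^ 2 ≤ c * b ^ 2 → a ≤ K * b := by
  refine ⟨NNReal.sqrt c.toNNReal, fun a b h => ?_⟩
  rw [← ENNReal.pow_le_pow_left_iff two_ne_zero, mul_pow, ← ENNReal.coe_pow, NNReal.sq_sqrt,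
    ENNReal.coe_toNNReal hc]
  exact h

lemma Comparable.mono {K K' : ℝ≥0} {a b : ℝ≥0∞} (h : Comparable K a b) (hK : K ≤ K') :
    Comparable K' a b := by
  have hK' : (K : ℝ≥0∞) ≤ K' := ENNReal.coe_le_coe.2 hK
  exact ⟨h.1.trans (by gcongr), h.2.trans (by gcongr)⟩

lemma Comparable.lt_top_iff {K : ℝ≥0} {a b : ℝ≥0∞} (h : Comparable K a b) :
    a < ∞ ↔ b < ∞ :=
  ⟨fun ha => h.2.trans_lt (ENNReal.mul_lt_top ENNReal.coe_lt_top ha),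
    fun hb => h.1.trans_lt (ENNReal.mul_lt_top ENNReal.coe_lt_top hb)⟩

variable {n m : ℕ}

/-- The estimate `a E ≲ b E`, uniformly in the measurable multiplier `E`. -/
def Dominated (a b : (Pt n → (Val n m →L[ℂ] Val n m)) → ℝ≥0∞) : Prop :=
  ∃ c : ℝ≥0, ∀ E, StronglyMeasurable E → a E ≤ c * b E

lemma Dominated.trans {a b c : (Pt n → (Val n m →L[ℂ] Val n m)) → ℝ≥0∞} (hab : Dominated a b)
    (hbc : Dominated b c) : Dominated a c := by
  obtain ⟨K, hK⟩ := hab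
  obtain ⟨L, hL⟩ := hbc
  refine ⟨K * L, fun E hE => (hK E hE).trans ?_⟩
  rw [ENNReal.coe_mul, mul_assoc]
  gcongr
  exact hL E hE

lemma Dominated.exists_comparable {a b : (Pt n → (Val n m →L[ℂ] Val n m)) → ℝ≥0∞}
    (hab : Dominated a b) (hba : Dominated b a) :
    ∃ K : ℝ≥0, ∀ E, StronglyMeasurable E → Comparable K (a E) (b E) := by
  obtain ⟨K, hK⟩ := hab
  obtain ⟨L, hL⟩ := hba
  refine ⟨max K L, fun E hE => ⟨(hK E hE).trans ?_, (hL E hE).trans ?_⟩⟩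
  · gcongr; exact le_max_left K L
  · gcongr; exact le_max_right K L

lemma dominated_of_testBound {B : (Pt n → (Val n m →L[ℂ] Val n m)) → ℝ≥0∞} {c : ℝ≥0∞}
    (hc : c ≠ ∞) (h : ∀ E, StronglyMeasurable E → TestBound E (c * B E ^ 2)) :
    Dominated carlesonDahlberg B := by
  obtain ⟨K, hK⟩ := exists_forall_le_mul_of_sq_le
    (c := ((1 + n) * m : ℕ) ^ 2 * (2 * 5 ^ (n + 1) * unitVol n * 3 ^ n) * c) (by finiteness)
  refine ⟨K, fun E hE => hK _ _ ?_⟩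
  rw [mul_assoc _ c]
  exact (h E hE).carlesonDahlberg_sq_le hE

variable (n m)

theorem carlesonDahlberg_dominated_opNorm_normN :
    Dominated (carlesonDahlberg (n := n) (m := m)) (opNorm normN (normL2 (-1))) :=
  dominated_of_testBound (by finiteness) fun _ _ => testBound_of_normL2 fun _ hf hfin =>
    le_opNorm_mul isDefiniteGauge_normN (isGauge_normL2 _) ⟨hf.aestronglyMeasurable, hfin⟩

theorem carlesonDahlberg_dominated_opNorm_normC :
    Dominated (carlesonDahlberg (n := n) (m := m)) (opNorm (normL2 1) normC) :=
  dominated_of_testBound (by finiteness [coe_unitVol_inv_ne_top n]) fun _ hE =>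
    testBound_of_normC hE fun _ hf hfin =>
      le_opNorm_mul (isDefiniteGauge_normL2 1) isGauge_normC ⟨hf.aestronglyMeasurable, hfin⟩

theorem opNorm_normN_dominated_carlesonDahlberg :
    Dominated (opNorm normN (normL2 (-1))) (carlesonDahlberg (n := n) (m := m)) := by
  obtain ⟨K, hK⟩ := exists_forall_le_mul_of_sq_le
    (c := 2 ^ (n + 1) * 12 ^ n * (unitVol n : ℝ≥0∞)⁻¹ ^ 2)
    (by finiteness [coe_unitVol_inv_ne_top n])
  refine ⟨K, fun E hE => opNorm_le isDefiniteGauge_normN.toIsGauge (isGauge_normL2 _)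
    fun f hf hf1 => ?_⟩
  simpa only [hf1, mul_one] using hK _ _ (normL2_mult_sq_le hE hf)

theorem opNorm_normA_dominated_carlesonDahlberg :
    Dominated (opNorm (normL2 1) normA) (carlesonDahlberg (n := n) (m := m)) := by
  obtain ⟨K, hK⟩ := exists_forall_le_mul_of_sq_le
    (c := 8 * 5 ^ n * 4 ^ (n + 1) * 12 ^ n * (unitVol n : ℝ≥0∞) ^ 2) (by finiteness)
  refine ⟨K, fun E hE => opNorm_le (isGauge_normL2 1) isGauge_normA fun f hf hf1 => ?_⟩
  simpa only [hf1, mul_one] using hK _ _ (normA_mult_sq_le hE hf)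

theorem opNorm_normC_dominated_opNorm_normA :
    Dominated (opNorm (normL2 1) normC) (opNorm (normL2 1) (normA (n := n) (m := m))) := by
  obtain ⟨K, hK⟩ := exists_forall_le_mul_of_sq_le (c := 8 * 5 ^ n) (by finiteness)
  refine ⟨K, fun E hE => opNorm_le (isGauge_normL2 1) isGauge_normC fun f hf hf1 => ?_⟩
  refine (hK _ _ (normC_sq_le (stronglyMeasurable_mult hE hf))).trans ?_
  gcongr
  exact le_opNorm hf.aestronglyMeasurable hf1

theorem exists_comparable_carlesonDahlberg_opNorm :
    ∃ K : ℝ≥0, ∀ E : Pt n → (Val n m →L[ℂ] Val n m), AEStronglyMeasurable E (halfVol n) →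
      Comparable K (carlesonDahlberg E) (opNorm normN (normL2 (-1)) E) ∧
      Comparable K (opNorm normN (normL2 (-1)) E) (opNorm (normL2 1) normC E) ∧
      Comparable K (opNorm normN (normL2 (-1)) E) (opNorm (normL2 1) normA E) := by
  have hDN := carlesonDahlberg_dominated_opNorm_normN n m
  have hDC := carlesonDahlberg_dominated_opNorm_normC n m
  have hND := opNorm_normN_dominated_carlesonDahlberg n m
  have hAD := opNorm_normA_dominated_carlesonDahlberg n m
  have hCA := opNorm_normC_dominated_opNorm_normA n m
  obtain ⟨K₁, hK₁⟩ := hDN.exists_comparable hND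
  obtain ⟨K₂, hK₂⟩ := (hND.trans hDC).exists_comparable (hCA.trans (hAD.trans hDN))
  obtain ⟨K₃, hK₃⟩ := (hND.trans (hDC.trans hCA)).exists_comparable (hAD.trans hDN)
  refine ⟨max K₁ (max K₂ K₃), fun E hE => ?_⟩
  rw [carlesonDahlberg_congr hE.ae_eq_mk, opNorm_congr (isGauge_normL2 _) hE.ae_eq_mk,
    opNorm_congr isGauge_normC hE.ae_eq_mk, opNorm_congr isGauge_normA hE.ae_eq_mk]
  have hE' := hE.stronglyMeasurable_mk
  exact ⟨(hK₁ _ hE').mono (le_max_left _ _),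
    (hK₂ _ hE').mono (le_max_of_le_right (le_max_left _ _)),
    (hK₃ _ hE').mono (le_max_of_le_right (le_max_right _ _))⟩

end Comparison

end CarlesonMult

end

theorem theorem2p4 (n m : ℕ) (hn : 1 ≤ n) (hm : 1 ≤ m) :
    (∀ E : CarlesonMult.Pt n → (CarlesonMult.Val n m →L[ℂ] CarlesonMult.Val n m),
      AEStronglyMeasurable E (CarlesonMult.halfVol n) →
      List.TFAE [
        CarlesonMult.IsBoundedMult CarlesonMult.normN (CarlesonMult.normL2 (-1)) E,
        CarlesonMult.IsBoundedMult (CarlesonMult.normL2 1) CarlesonMult.normC E,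
        CarlesonMult.IsBoundedMult (CarlesonMult.normL2 1) CarlesonMult.normA E,
        CarlesonMult.carlesonDahlberg E < ∞]) ∧
    ∃ K : ℝ≥0, ∀ E : CarlesonMult.Pt n → (CarlesonMult.Val n m →L[ℂ] CarlesonMult.Val n m),
      AEStronglyMeasurable E (CarlesonMult.halfVol n) →
      CarlesonMult.Comparable K (CarlesonMult.carlesonDahlberg E)
        (CarlesonMult.opNorm CarlesonMult.normN (CarlesonMult.normL2 (-1)) E) ∧
      CarlesonMult.Comparable K
        (CarlesonMult.opNorm CarlesonMult.normN (CarlesonMult.normL2 (-1)) E)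
        (CarlesonMult.opNorm (CarlesonMult.normL2 1) CarlesonMult.normC E) ∧
      CarlesonMult.Comparable K
        (CarlesonMult.opNorm CarlesonMult.normN (CarlesonMult.normL2 (-1)) E)
        (CarlesonMult.opNorm (CarlesonMult.normL2 1) CarlesonMult.normA E) := by
  obtain ⟨K, hK⟩ := CarlesonMult.exists_comparable_carlesonDahlberg_opNorm n m
  refine ⟨fun E hE => ?_, K, hK⟩
  obtain ⟨hDN, hNC, hNA⟩ := hK E hE
  rw [CarlesonMult.isBoundedMult_iff CarlesonMult.isDefiniteGauge_normN
      (CarlesonMult.isGauge_normL2 _) hE,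
    CarlesonMult.isBoundedMult_iff (CarlesonMult.isDefiniteGauge_normL2 1)
      CarlesonMult.isGauge_normC hE,
    CarlesonMult.isBoundedMult_iff (CarlesonMult.isDefiniteGauge_normL2 1)
      CarlesonMult.isGauge_normA hE]
  tfae_have 1 ↔ 4 := hDN.lt_top_iff.symm
  tfae_have 1 ↔ 2 := hNC.lt_top_iff
  tfae_have 1 ↔ 3 := hNA.lt_top_iff
  tfae_finish
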